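/- Let $d,N\ge 0$, let $T>0$, and let finitely many pairwise distinct hyperplanes $\mathcal H_1,\dots,\mathcal H_q$ of $\mathbb R^d$ be given which form at most two sets of parallel hyperplanes, hyperplanes of different sets being orthogonal. Put $\Gamma=\bigcup_j\mathcal H_j$ and **(H1)** $\mathbb R^d=\Gamma\cup\bigcup_{i=1}^m\Omega_i$, where the $\Omega_i$ are open, connected, pairwise disjoint and disjoint from $\Gamma$. Let $\Gamma_k$ be the intersections of two crossing hyperplanes together with the connected components of what these intersections leave of each hyperplane, and let $(\mathcal M_k)_k$ be the family of all $\Omega_i$ and all $\Gamma_k$, a partition of $\mathbb R^d$. Let $\mathscr A\subset\mathbb R^N$ be compact, $f:\mathbb R^d\times\mathscr A\to\mathbb R^d$, $\ell:\mathbb R^d\times\mathscr A\to\mathbb R$, $F(x)=f(x,\mathscr A)$, $L(x)=\ell(x,\mathscr A)$. Consider the hypotheses **(HF)** $F$ has nonempty compact values and is upper semicontinuous; for every $k$ and every $R>0$ the restriction of $F$ to $\mathcal M_k\cap\{|x|\le R\}$ is Lipschitz for the Hausdorff distance; there is $c_f>0$ with $|p|\le c_f(1+|x|)$ for all $x$ and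 all $p\in F(x)$. **(HL)** $L$ has nonempty compact values and is upper semicontinuous; for every $k$ and every $R>0$ the restriction of $L$ to $\mathcal M_k\cap\{|x|\le R\}$ is Lipschitz for the Hausdorff distance; there are $c_l>0$ and $\lambda_l\ge1$ with $0\le l\le c_l(1+|x|^{\lambda_l})$ for all $x$ and all $l\in L(x)$. **(HG)** The multifunction $G(x)=\{(f(x,a),-\ell(x,a)-r): a\in\mathscr A,\ 0\le r\le c_l(1+|x|^{\lambda_l})-\ell(x,a)\}$ is upper semicontinuous with compact convex values. **(H2)** There is $r_1>0$ with $B(0,r_1)\subset F(x)$ for all $x\in\Gamma$. For $x\in\overline{\mathcal M_k}$ let $F^{\rm ext}_k(x)$ be the value at $x$ of the extension by continuity of $F|_{\mathcal M_k}$ to $\overline{\mathcal M_k}$, that is, the set of all limits of $v_j\in F(x_j)$ with $x_j\in\mathcal M_k$, $x_j\to x$; let $\mathcal T_{C}(x)=\{v:\liminf_{t\to0^+}\operatorname{dist}(x+tv,C)/t=0\}$, and $$A^E(x)=\{a\in\mathscr A:\ f(x,a)\in F^{\rm ext}_k(x)\cap\mathcal T_{\overline{\mathcal M_k}}(x)\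 \text{for some }k\text{ with }x\in\overline{\mathcal M_k}\},$$ $$H^E(x,p)=\sup_{a\in A^E(x)}\{-p\cdot f(x,a)-\ell(x,a)\}\in[-\infty,\infty],\qquad \sup\emptyset=-\infty .$$ A function $u$ on $[0,T]\times\mathbb R^d$ is a supersolution of $-\partial_tu+H^E(x,Du)=0$ if it is lower semicontinuous on $(0,T]\times\mathbb R^d$ and, whenever $\phi\in C^1((0,T)\times\mathbb R^d)$ and $u-\phi$ has a local minimum at $(t_0,x_0)\in(0,T)\times\mathbb R^d$, one has $-\phi_t(t_0,x_0)+H^E(x_0,D\phi(t_0,x_0))\ge0$. **Theorem.** Assume (H1), (HF), (HL), (HG), (H2). Let $f^n:\mathbb R^d\times\mathscr A\to\mathbb R^d$ and $\ell^n:\mathbb R^d\times\mathscr A\to\mathbb R$ satisfy (HF) and (HL) with constants (growth constants and exponent, and local Lipschitz constants) that do not depend on $n$, and let $f^n\to f$ and $\ell^n\to\ell$ locally uniformly in $\mathbb R^d\times\mathscr A$. Let $H^{E,n}$ be the Hamiltonian $H^E$ built from $f^n,\ell^n$. If $u_n$ is a lower semicontinuous supersolution of $-\partial_tu_n+H^{E,n}(x,Du_n)=0$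 for each $n$ and $u_n$ converges locally uniformly in $[0,T]\times\mathbb R^d$ to a lower semicontinuous function $u$, then $u$ is a supersolution of $-\partial_tu+H^E(x,Du)=0$ on $(0,T)\times\mathbb R^d$, junction conditions on $\Gamma$ included. -/

import Mathlib

open Set Filter Topology

/-- The Euclidean space `ℝ^d`. -/
abbrev Euc (d : ℕ) : Type := EuclideanSpace ℝ (Fin d)

/-- A decomposition of `ℝ^d` into cells `Ω i` separated by finitely many pairwise distinct
hyperplanes `{x | ⟪normal j, x⟫ = offset j}`. The hyperplanes form two sets of parallel hyperplanes
(either of which may be empty), with one unit normal direction chosen for each set, and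
hyperplanes of different sets are orthogonal. -/
structure MultiDomain (d : ℕ) where
  /-- number of hyperplanes -/
  q : ℕ
  /-- number of cells -/
  m : ℕ
  /-- unit normals of the hyperplanes -/
  normal : Fin q → Euc d
  /-- offsets of the hyperplanes -/
  offset : Fin q → ℝ
  /-- which of the two sets of parallel hyperplanes the hyperplane belongs to -/
  family : Fin q → Fin 2
  norm_normal : ∀ j, ‖normal j‖ = 1
  normal_eq : ∀ i j, family i = family j → normal i = normal j
  normal_orthogonal : ∀ i j, family i ≠ family j → inner ℝ (normal i) (normal j) = 0
  hyperplanes_distinct :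
    Function.Injective fun j => {x : Euc d | inner ℝ (normal j) x = offset j}
  /-- the cells -/
  Ω : Fin m → Set (Euc d)
  cover : (⋃ j, {x : Euc d | inner ℝ (normal j) x = offset j}) ∪ (⋃ i, Ω i) = univ
  inter_eq_empty : ∀ i, (⋃ j, {x : Euc d | inner ℝ (normal j) x = offset j}) ∩ Ω i = ∅
  isOpen_Ω : ∀ i, IsOpen (Ω i)
  isConnected_Ω : ∀ i, IsConnected (Ω i)
  disjoint_Ω : ∀ i j, i ≠ j → Disjoint (Ω i) (Ω j)

namespace MultiDomain

variable {d : ℕ} (D : MultiDomain d)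

/-- The union `Γ` of the hyperplanes. -/
def Γ : Set (Euc d) := ⋃ j, {x : Euc d | inner ℝ (D.normal j) x = D.offset j}

/-- The set of points having a prescribed position with respect to every hyperplane. -/
def face (σ : Fin D.q → SignType) : Set (Euc d) :=
  {x | ∀ j, SignType.sign (inner ℝ (D.normal j) x - D.offset j) = σ j}

/-- The pieces `Γ_k` of `Γ`: the intersections of two crossing hyperplanes and the connected
components of what these intersections leave of each hyperplane. They are the nonempty faces on
which at least one of the hyperplane equations holds. -/
def interfaces : Set (Set (Euc d)) :=
  {M | M.Nonempty ∧ ∃ σ : Fin D.q → SignType, (∃ j, σ j = 0) ∧ M = D.face σ}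

/-- The subdomains `M_k`: the cells and the pieces of the interface `Γ`. -/
def strata : Set (Set (Euc d)) := range D.Ω ∪ D.interfaces

end MultiDomain

/-- The tangent cone `{v | liminf_{t → 0⁺} dist (x + t v, C) / t = 0}` of `C` at `x`. -/
def tangentConeOf {d : ℕ} (C : Set (Euc d)) (x : Euc d) : Set (Euc d) :=
  {v | liminf (fun t : ℝ => Metric.infDist (x + t • v) C / t) (𝓝[>] 0) = 0}

section Control

variable {d N : ℕ} (D : MultiDomain d) (A : Set (Euc N))
  (f : Euc d → Euc N → Euc d) (ℓ : Euc d → Euc N → ℝ)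

/-- The dynamics `F(x) = {f(x,a) : a ∈ A}`. -/
def dynamics (x : Euc d) : Set (Euc d) := f x '' A

/-- The running costs `L(x) = {ℓ(x,a) : a ∈ A}`. -/
def costs (x : Euc d) : Set ℝ := ℓ x '' A

/-- The augmented dynamics
`G(x) = {(f(x,a), -ℓ(x,a) - r) : a ∈ A, 0 ≤ r ≤ b(x,a)}`, `b(x,a) = c (1 + |x|^lam) - ℓ(x,a)`. -/
def augmentedDynamics (c lam : ℝ) (x : Euc d) : Set (Euc d × ℝ) :=
  {z | ∃ a ∈ A, ∃ r : ℝ, 0 ≤ r ∧ r ≤ c * (1 + ‖x‖ ^ lam) - ℓ x a ∧ z = (f x a, -ℓ x a - r)}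

/-- Local Lipschitz continuity, for the Hausdorff distance and up to the boundary of `M`, of the
restriction of `Φ` to `M`; `K R` is a Lipschitz constant on the part of `M` in the ball of
radius `R`. -/
def HausdorffLipschitzOn {Y : Type*} [PseudoMetricSpace Y] (Φ : Euc d → Set Y) (M : Set (Euc d))
    (K : ℝ → ℝ) : Prop :=
  ∀ R : ℝ, ∀ x ∈ M ∩ Metric.closedBall 0 R, ∀ y ∈ M ∩ Metric.closedBall 0 R,
    Metric.hausdorffDist (Φ x) (Φ y) ≤ K R * dist x y

/-- Standing hypothesis on the dynamics, with growth constant `c` and local Lipschitz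
constants `K`. -/
structure HF (c : ℝ) (K : ℝ → ℝ) : Prop where
  nonempty : ∀ x, (dynamics A f x).Nonempty
  isCompact : ∀ x, IsCompact (dynamics A f x)
  usc : UpperHemicontinuous (dynamics A f)
  lipschitz : ∀ M ∈ D.strata, HausdorffLipschitzOn (dynamics A f) M K
  const_pos : 0 < c
  growth : ∀ x, ∀ p ∈ dynamics A f x, ‖p‖ ≤ c * (1 + ‖x‖)

/-- Standing hypothesis on the running costs, with growth constants `c`, `lam` and local Lipschitz
constants `K`. -/
structure HL (c lam : ℝ) (K : ℝ → ℝ) : Prop where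
  nonempty : ∀ x, (costs A ℓ x).Nonempty
  isCompact : ∀ x, IsCompact (costs A ℓ x)
  usc : UpperHemicontinuous (costs A ℓ)
  lipschitz : ∀ M ∈ D.strata, HausdorffLipschitzOn (costs A ℓ) M K
  const_pos : 0 < c
  one_le : 1 ≤ lam
  growth : ∀ x, ∀ l ∈ costs A ℓ x, 0 ≤ l ∧ l ≤ c * (1 + ‖x‖ ^ lam)

/-- The extension by continuity to `closure M` of the restriction of `F` to `M`, given by the
closure of the graph of this restriction: its value at `x` is the set of the limits of sequences
`v_n ∈ F(x_n)` with `x_n ∈ M`, `x_n → x`. -/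
def extDynamics (M : Set (Euc d)) (x : Euc d) : Set (Euc d) :=
  {v | (x, v) ∈ closure {z : Euc d × Euc d | z.1 ∈ M ∧ z.2 ∈ dynamics A f z.1}}

/-- The essential dynamics `F^E_M(x)` of the subdomain `M`. -/
def essDynamicsOn (M : Set (Euc d)) (x : Euc d) : Set (Euc d) :=
  extDynamics A f M x ∩ tangentConeOf (closure M) x

/-- The essential controls `A^E(x)`: those `a ∈ A` with `f(x,a) ∈ F^E_M(x)` for some subdomain `M`
whose closure contains `x`. -/
def essControls (x : Euc d) : Set (Euc N) :=
  {a | a ∈ A ∧ ∃ M ∈ D.strata, x ∈ closure M ∧ f x a ∈ essDynamicsOn A f M x}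

/-- The essential Hamiltonian `H^E(x,p) = sup_{a ∈ A^E(x)} (-p · f(x,a) - ℓ(x,a))`, extended-real
valued so that the supremum over an empty set of controls is `-∞`. -/
noncomputable def essHamiltonian (x p : Euc d) : EReal :=
  ⨆ a ∈ essControls D A f x, ((-inner ℝ p (f x a) - ℓ x a : ℝ) : EReal)

/-- Viscosity supersolutions of `-∂_t u + H^E(x, Du) = 0` on `(0,T) × ℝ^d`, junction conditions on
`Γ` included. -/
def IsSupersolution (T : ℝ) (u : ℝ × Euc d → ℝ) : Prop :=
  LowerSemicontinuousOn u (Ioc 0 T ×ˢ univ) ∧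
    ∀ t₀ ∈ Ioo 0 T, ∀ x₀ : Euc d, ∀ φ : ℝ × Euc d → ℝ,
      ContDiffOn ℝ 1 φ (Ioo 0 T ×ˢ univ) →
      IsLocalMin (fun z => u z - φ z) (t₀, x₀) →
      0 ≤ ((-deriv (fun t => φ (t, x₀)) t₀ : ℝ) : EReal)
        + essHamiltonian D A f ℓ x₀ (gradient (fun x => φ (t₀, x)) x₀)

end Control

/-!
For supersolutions of the equation in which all controls of `A` are allowed, stability is the
classical argument: minima of `u - φ` are limits of minima of `u_n - φ`, and `G` is compact and
upper semicontinuous. It remains to see that a supersolution for all controls is a supersolution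
for the essential ones.

Suppose that at a minimum `z₀ = (t₀, x₀)` of `u - φ` every essential control violates the
inequality. For each face adjacent to `x₀`, separating the compact convex set of pairs in `G(x₀)`
with dynamics in the extension from that face from the pairs whose dynamics are tangent to it yields
a slope `s τ` in the at most two coordinates normal to the hyperplanes through `x₀`, decreasing
into the face, such that every control with dynamics in the extension violates the inequality once
`s τ` is added to `Dφ`. This persists near `z₀`, so at a nearby point the slopes of all faces
adjacent to it, and their convex combinations, are available. There is a `C¹` bump in the two
normal coordinates whose gradients, wherever it is positive, are all of this kind. Subtracting a
small rescaled copy of it moves the minimum to a nearby point at which no control of `A` satisfies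
the inequality, a contradiction.
-/

/-! ### A `C¹` minimum of two functions -/

section SmoothMin

/-- A `C¹` approximation of the positive part `t ↦ max t 0`: its derivative climbs linearly from `0`
to `1` on `[0, 1]`. -/
noncomputable def ramp (t : ℝ) : ℝ := (max t 0 ^ 2 - max (t - 1) 0 ^ 2) / 2

theorem hasDerivAt_sq_max_zero (t : ℝ) :
    HasDerivAt (fun t : ℝ => max t 0 ^ 2) (2 * max t 0) t := by
  refine hasDerivAt_of_hasDerivAt_of_ne' (g := fun t : ℝ => 2 * max t 0) (x := 0) (fun t ht => ?_)
    (by fun_prop) (by fun_prop) t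
  rcases ht.lt_or_gt with ht | ht
  · rw [max_eq_right ht.le, mul_zero]
    refine (hasDerivAt_const t (0 : ℝ)).congr_of_eventuallyEq ?_
    filter_upwards [Iio_mem_nhds ht] with s hs
    rw [max_eq_right (le_of_lt hs), zero_pow two_ne_zero]
  · rw [max_eq_left ht.le]
    refine (by simpa using hasDerivAt_pow 2 t : HasDerivAt (· ^ 2) (2 * t) t)
      |>.congr_of_eventuallyEq ?_
    filter_upwards [Ioi_mem_nhds ht] with s hs
    rw [max_eq_left (le_of_lt hs)]

theorem hasDerivAt_ramp (t : ℝ) : HasDerivAt ramp (max t 0 - max (t - 1) 0) t := by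
  refine (((hasDerivAt_sq_max_zero t).sub
    ((hasDerivAt_sq_max_zero (t - 1)).comp_sub_const t 1)).div_const 2).congr_deriv ?_
  ring

theorem deriv_ramp : deriv ramp = fun t => max t 0 - max (t - 1) 0 :=
  funext fun t => (hasDerivAt_ramp t).deriv

theorem contDiff_ramp : ContDiff ℝ 1 ramp :=
  contDiff_one_iff_deriv.2
    ⟨fun t => (hasDerivAt_ramp t).differentiableAt, by rw [deriv_ramp]; fun_prop⟩

theorem hasDerivAt_deriv_ramp (t : ℝ) : HasDerivAt ramp (deriv ramp t) t :=
  (hasDerivAt_ramp t).differentiableAt.hasDerivAt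

theorem deriv_ramp_mem_Icc (t : ℝ) : deriv ramp t ∈ Icc (0 : ℝ) 1 := by
  rw [deriv_ramp]
  constructor <;>
  rcases max_cases t 0 with h | h <;> rcases max_cases (t - 1) 0 with h' | h' <;> linarith

theorem deriv_ramp_of_nonpos {t : ℝ} (h : t ≤ 0) : deriv ramp t = 0 := by
  simp [deriv_ramp, max_eq_right h, max_eq_right (by linarith : t - 1 ≤ 0)]

theorem deriv_ramp_of_one_le {t : ℝ} (h : 1 ≤ t) : deriv ramp t = 1 := by
  simp [deriv_ramp, max_eq_left (by linarith : 0 ≤ t), max_eq_left (by linarith : 0 ≤ t - 1)]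

theorem ramp_of_nonpos {t : ℝ} (h : t ≤ 0) : ramp t = 0 := by
  simp [ramp, max_eq_right h, max_eq_right (by linarith : t - 1 ≤ 0)]

theorem ramp_nonneg (t : ℝ) : 0 ≤ ramp t := by
  have hle : max (t - 1) 0 ≤ max t 0 := max_le_max (by linarith) le_rfl
  have := pow_le_pow_left₀ (le_max_right _ _) hle 2
  unfold ramp; linarith

theorem ramp_le {t : ℝ} (h : 0 ≤ t) : ramp t ≤ t := by
  unfold ramp
  rcases max_cases (t - 1) 0 with h' | h' <;> rw [max_eq_left h, h'.1] <;> nlinarith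

theorem sub_half_le_ramp (t : ℝ) : t - 1 / 2 ≤ ramp t := by
  unfold ramp
  rcases max_cases t 0 with h | h <;> rcases max_cases (t - 1) 0 with h' | h' <;>
    rw [h.1, h'.1] <;> nlinarith [sq_nonneg (t - 1)]

/-- A `C¹` approximation of the minimum of two real numbers. -/
noncomputable def smin (x y : ℝ) : ℝ := x - ramp (x - y)

theorem smin_le_left (x y : ℝ) : smin x y ≤ x := sub_le_self _ (ramp_nonneg _)

theorem smin_le_right (x y : ℝ) : smin x y ≤ y + 1 / 2 := by
  have := sub_half_le_ramp (x - y)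
  unfold smin; linarith

theorem smin_eq_left {x y : ℝ} (h : x ≤ y) : smin x y = x := by
  rw [smin, ramp_of_nonpos (sub_nonpos.2 h), sub_zero]

variable {V : Type*} [NormedAddCommGroup V] [NormedSpace ℝ V]

theorem contDiff_smin {f h : V → ℝ} (hf : ContDiff ℝ 1 f) (hh : ContDiff ℝ 1 h) :
    ContDiff ℝ 1 fun y => smin (f y) (h y) :=
  hf.sub (contDiff_ramp.comp (hf.sub hh))

theorem hasFDerivAt_smin {f h : V → ℝ} {f' h' : V →L[ℝ] ℝ} {y : V}
    (hf : HasFDerivAt f f' y) (hh : HasFDerivAt h h' y) :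
    HasFDerivAt (fun y => smin (f y) (h y))
      (AffineMap.lineMap f' h' (deriv ramp (f y - h y))) y := by
  refine (hf.sub ((hasDerivAt_deriv_ramp _).comp_hasFDerivAt y (hf.sub hh))).congr_fderiv ?_
  rw [AffineMap.lineMap_apply_module']
  module

end SmoothMin

/-! ### Functions with prescribed slopes on the orthants -/

section Slopes

variable {ι : Type*}

/-- `τ` is the sign vector of a face of the closed orthant with sign vector `σ`. -/
def IsFace (τ σ : ι → SignType) : Prop := ∀ i, τ i = 0 ∨ τ i = σ i

/-- The slopes available at the points with sign vector `σ`, when a slope `s τ` is attached to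
every sign vector `τ`: the convex combinations of the slopes attached to the faces of `σ`. -/
def slopeHull (s : (ι → SignType) → ι → ℝ) (σ : ι → SignType) : Set (ι → ℝ) :=
  convexHull ℝ (s '' {τ | IsFace τ σ})

/-- The slopes `s` are nonzero in every coordinate, and `s τ` makes an affine function decrease away
from `0` in the coordinates in which `τ` is nonzero. -/
structure IsInward (s : (ι → SignType) → ι → ℝ) : Prop where
  ne_zero : ∀ τ i, s τ i ≠ 0
  sign_eq_neg : ∀ τ i, τ i ≠ 0 → SignType.sign (s τ i) = -τ i

theorem slope_mem_slopeHull (s : (ι → SignType) → ι → ℝ) {τ σ : ι → SignType} (h : IsFace τ σ) :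
    s τ ∈ slopeHull s σ :=
  subset_convexHull ℝ _ (mem_image_of_mem s h)

theorem segment_subset_slopeHull (s : (ι → SignType) → ι → ℝ) {τ τ' σ : ι → SignType}
    (h : IsFace τ σ) (h' : IsFace τ' σ) : segment ℝ (s τ) (s τ') ⊆ slopeHull s σ :=
  (convex_convexHull ℝ _).segment_subset (slope_mem_slopeHull s h) (slope_mem_slopeHull s h')

/-- The slopes which become the slopes `s` under the change of variables `y ↦ e * y`. -/
noncomputable def rescaleSlopes (e : ι → ℝ) (s : (ι → SignType) → ι → ℝ) (τ : ι → SignType) :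
    ι → ℝ :=
  e⁻¹ * s fun i => SignType.sign (e i) * τ i

theorem IsInward.rescale {s : (ι → SignType) → ι → ℝ} (hs : IsInward s) {e : ι → ℝ}
    (he : ∀ i, e i ≠ 0) : IsInward (rescaleSlopes e s) where
  ne_zero τ i := mul_ne_zero (inv_ne_zero (he i)) (hs.ne_zero _ i)
  sign_eq_neg τ i hi := by
    have hsign := hs.sign_eq_neg (fun i => SignType.sign (e i) * τ i) i
      (mul_ne_zero (sign_ne_zero.2 (he i)) hi)
    rw [rescaleSlopes, Pi.mul_apply, sign_mul, hsign, Pi.inv_apply]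
    rcases (he i).lt_or_gt with h | h
    · rw [sign_neg h, sign_neg (inv_lt_zero.2 h), neg_one_mul, neg_one_mul, neg_neg]
    · rw [sign_pos h, sign_pos (inv_pos.2 h), one_mul, one_mul]

variable [Fintype ι]

/-- The linear form on `ι → ℝ` with gradient `g`. -/
noncomputable def slopeForm (g : ι → ℝ) : (ι → ℝ) →L[ℝ] ℝ :=
  ∑ i, g i • ContinuousLinearMap.proj i

theorem slopeForm_apply (g y : ι → ℝ) : slopeForm g y = ∑ i, g i * y i := by
  simp [slopeForm]

theorem slopeForm_comm (g y : ι → ℝ) : slopeForm g y = slopeForm y g := by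
  simp only [slopeForm_apply, mul_comm]

theorem slopeForm_lineMap (g k : ι → ℝ) (t : ℝ) :
    slopeForm (AffineMap.lineMap g k t) = AffineMap.lineMap (slopeForm g) (slopeForm k) t := by
  simp only [slopeForm, AffineMap.lineMap_apply_module, Pi.add_apply, Pi.smul_apply, add_smul,
    Finset.sum_add_distrib, smul_eq_mul, mul_smul, Finset.smul_sum]

theorem isBounded_of_lt_slopeForm {g : ι → ℝ} (hg : ∀ i, g i ≠ 0) (r c : ℝ) :
    Bornology.IsBounded {y | (∀ i, g i * y i ≤ r) ∧ c < slopeForm g y} := by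
  classical
  rw [← Bornology.forall_isBounded_image_eval_iff]
  refine fun i => (Metric.isBounded_closedBall (x := (0 : ℝ))
    (r := (|c - (Finset.univ.erase i).card • r| + |r|) / |g i|)).subset ?_
  rintro _ ⟨y, ⟨hle, hlt⟩, rfl⟩
  rw [slopeForm_apply, ← Finset.add_sum_erase _ _ (Finset.mem_univ i)] at hlt
  have hsum : ∑ j ∈ Finset.univ.erase i, g j * y j ≤ (Finset.univ.erase i).card • r :=
    Finset.sum_le_card_nsmul _ _ _ fun j _ => hle j
  rw [mem_closedBall_zero_iff, Real.norm_eq_abs, Function.eval, le_div_iff₀ (abs_pos.2 (hg i)),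
    ← abs_mul, mul_comm, abs_le]
  have := neg_abs_le (c - (Finset.univ.erase i).card • r)
  have := abs_nonneg (c - (Finset.univ.erase i).card • r)
  have := le_abs_self r
  have := abs_nonneg r
  constructor <;> linarith [hle i]

/-- `ψ` is differentiable at `y`, with one of the slopes available at the sign vector of `y` as its
gradient. -/
def HasSlopeAt (s : (ι → SignType) → ι → ℝ) (ψ : (ι → ℝ) → ℝ) (y : ι → ℝ) : Prop :=
  ∃ g ∈ slopeHull s fun i => SignType.sign (y i), HasFDerivAt ψ (slopeForm g) y

/-- A bump around `0` with prescribed slopes: a `C¹` function, positive at `0`, which has one of the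
available slopes wherever it is positive. -/
structure IsAdmissible (s : (ι → SignType) → ι → ℝ) (ψ : (ι → ℝ) → ℝ) : Prop where
  contDiff : ContDiff ℝ 1 ψ
  pos_zero : 0 < ψ 0
  hasSlopeAt : ∀ y, 0 < ψ y → HasSlopeAt s ψ y

variable {s : (ι → SignType) → ι → ℝ} {ψ h : (ι → ℝ) → ℝ} {y : ι → ℝ}

theorem hasSlopeAt_slopeForm {τ : ι → SignType} (hτ : IsFace τ fun i => SignType.sign (y i)) :
    HasSlopeAt s (slopeForm (s τ)) y :=
  ⟨s τ, slope_mem_slopeHull s hτ, (slopeForm (s τ)).hasFDerivAt⟩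

theorem HasSlopeAt.const_add (hh : HasSlopeAt s h y) (c : ℝ) :
    HasSlopeAt s (fun y => c + h y) y :=
  let ⟨g, hg, hd⟩ := hh
  ⟨g, hg, hd.const_add c⟩

theorem hasSlopeAt_smin (hψ : HasSlopeAt s ψ y) (hh : HasSlopeAt s h y) :
    HasSlopeAt s (fun y => smin (ψ y) (h y)) y := by
  obtain ⟨g, hg, hψd⟩ := hψ
  obtain ⟨k, hk, hhd⟩ := hh
  refine ⟨AffineMap.lineMap g k (deriv ramp (ψ y - h y)),
    (convex_convexHull ℝ _).segment_subset hg hk ?_, ?_⟩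
  · rw [segment_eq_image_lineMap]
    exact mem_image_of_mem _ (deriv_ramp_mem_Icc _)
  · rw [slopeForm_lineMap]
    exact hasFDerivAt_smin hψd hhd

theorem hasSlopeAt_smin_of_le (hψ : HasSlopeAt s ψ y) (hh : DifferentiableAt ℝ h y)
    (hle : ψ y ≤ h y) : HasSlopeAt s (fun y => smin (ψ y) (h y)) y := by
  obtain ⟨g, hg, hψd⟩ := hψ
  refine ⟨g, hg, (hasFDerivAt_smin hψd hh.hasFDerivAt).congr_fderiv ?_⟩
  rw [deriv_ramp_of_nonpos (sub_nonpos.2 hle), AffineMap.lineMap_apply_zero]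

theorem hasSlopeAt_smin_of_add_one_le (hψ : DifferentiableAt ℝ ψ y) (hh : HasSlopeAt s h y)
    (hle : h y + 1 ≤ ψ y) : HasSlopeAt s (fun y => smin (ψ y) (h y)) y := by
  obtain ⟨g, hg, hhd⟩ := hh
  refine ⟨g, hg, (hasFDerivAt_smin hψ.hasFDerivAt hhd).congr_fderiv ?_⟩
  rw [deriv_ramp_of_one_le (by linarith), AffineMap.lineMap_apply_one]

theorem IsAdmissible.one_add_slopeForm (s : (ι → SignType) → ι → ℝ) :
    IsAdmissible s fun y => 1 + slopeForm (s 0) y where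
  contDiff := contDiff_const.add (slopeForm (s 0)).contDiff
  pos_zero := by simp
  hasSlopeAt _ _ := (hasSlopeAt_slopeForm fun _ => .inl rfl).const_add 1

/-- Raise `h` by a constant until `ψ` is the smaller of the two functions wherever the slope of `h`
is not available: the smooth minimum of the two then only uses available slopes. -/
theorem IsAdmissible.exists_cut (hψ : IsAdmissible s ψ) (hh : ContDiff ℝ 1 h)
    (hbdd : Bornology.IsBounded {y | 0 < ψ y ∧ ¬HasSlopeAt s h y}) :
    ∃ c ψ', IsAdmissible s ψ' ∧ ∀ y, 0 < ψ' y → 0 < ψ y ∧ c < h y := by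
  obtain ⟨b, hb⟩ := hbdd.isCompact_closure.bddAbove_image
    (hψ.contDiff.continuous.sub hh.continuous).continuousOn
  set c := max b (ψ 0 - h 0)
  have hpos : ∀ {y}, 0 < smin (ψ y) (c + h y) → 0 < ψ y := fun hy => hy.trans_le (smin_le_left _ _)
  refine ⟨-(c + 1 / 2), fun y => smin (ψ y) (c + h y),
    ⟨contDiff_smin hψ.contDiff (contDiff_const.add hh), ?_, fun y hy => ?_⟩,
    fun y hy => ⟨hpos hy, by linarith [smin_le_right (ψ y) (c + h y)]⟩⟩
  · rw [smin_eq_left (by linarith [le_max_right b (ψ 0 - h 0)])]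
    exact hψ.pos_zero
  · by_cases hslope : HasSlopeAt s h y
    · exact hasSlopeAt_smin (hψ.hasSlopeAt y (hpos hy)) (hslope.const_add c)
    · refine hasSlopeAt_smin_of_le (hψ.hasSlopeAt y (hpos hy))
        ((hh.differentiable one_ne_zero y).const_add c) ?_
      have : ψ y - h y ≤ b := hb (mem_image_of_mem _ (subset_closure ⟨hpos hy, hslope⟩))
      linarith [le_max_left b (ψ 0 - h 0)]

theorem IsAdmissible.exists_cut_slope (hψ : IsAdmissible s ψ) (τ : ι → SignType)
    (hbdd : Bornology.IsBounded {y | 0 < ψ y ∧ ¬IsFace τ fun i => SignType.sign (y i)}) :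
    ∃ c ψ', IsAdmissible s ψ' ∧ ∀ y, 0 < ψ' y → 0 < ψ y ∧ c < slopeForm (s τ) y :=
  hψ.exists_cut (slopeForm (s τ)).contDiff <| hbdd.subset fun _ hy =>
    ⟨hy.1, fun hτ => hy.2 (hasSlopeAt_slopeForm hτ)⟩

theorem IsAdmissible.exists_isBounded (hψ : IsAdmissible s ψ) (hs : IsInward s) {τ : ι → SignType}
    (hτ : ∀ i, τ i ≠ 0)
    (hbdd : Bornology.IsBounded {y | 0 < ψ y ∧ ¬IsFace τ fun i => SignType.sign (y i)}) :
    ∃ ψ', IsAdmissible s ψ' ∧ Bornology.IsBounded {y | 0 < ψ' y} := by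
  obtain ⟨c, ψ', hψ', hpos⟩ := hψ.exists_cut_slope τ hbdd
  refine ⟨ψ', hψ',
    (hbdd.union (isBounded_of_lt_slopeForm (hs.ne_zero τ) 0 c)).subset fun y hy => ?_⟩
  by_cases hface : IsFace τ fun i => SignType.sign (y i)
  · refine .inr ⟨fun i => ?_, (hpos y hy).2⟩
    have hy : SignType.sign (y i) = τ i := ((hface i).resolve_left (hτ i)).symm
    have hsign := hs.sign_eq_neg τ i (hτ i)
    rcases SignType.trichotomy (τ i) with h | h | h <;> rw [h] at hsign hy
    · exact mul_nonpos_of_nonneg_of_nonpos (sign_eq_one_iff.1 hsign).le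
        (sign_eq_neg_one_iff.1 hy).le
    · exact absurd h (hτ i)
    · exact mul_nonpos_of_nonpos_of_nonneg (sign_eq_neg_one_iff.1 hsign).le
        (sign_eq_one_iff.1 hy).le
  · exact .inl ⟨(hpos y hy).1, hface⟩

theorem IsAdmissible.bddAbove (hψ : IsAdmissible s ψ)
    (hbdd : Bornology.IsBounded {y | 0 < ψ y}) : BddAbove (range ψ) := by
  obtain ⟨b, hb⟩ := hbdd.isCompact_closure.bddAbove_image hψ.contDiff.continuous.continuousOn
  refine ⟨max b 0, ?_⟩
  rintro _ ⟨y, rfl⟩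
  by_cases hy : 0 < ψ y
  · exact (hb (mem_image_of_mem _ (subset_closure hy))).trans (le_max_left _ _)
  · exact (not_lt.1 hy).trans (le_max_right _ _)

theorem HasSlopeAt.rescale {e : ι → ℝ} (he : ∀ i, e i ≠ 0)
    (hψ : HasSlopeAt (rescaleSlopes e s) ψ (e * y)) : HasSlopeAt s (fun y => ψ (e * y)) y := by
  obtain ⟨g, hg, hd⟩ := hψ
  refine ⟨e * g, ?_, (hd.comp y (ContinuousLinearMap.mul ℝ (ι → ℝ) e).hasFDerivAt).congr_fderiv ?_⟩
  · have := mem_image_of_mem (LinearMap.mulLeft ℝ e) hg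
    rw [slopeHull, LinearMap.image_convexHull, image_image] at this
    refine convexHull_mono ?_ this
    rintro _ ⟨τ, hτ, rfl⟩
    refine ⟨fun i => SignType.sign (e i) * τ i, fun i => ?_,
      funext fun i => (mul_inv_cancel_left₀ (he i) _).symm⟩
    refine (hτ i).imp (fun h => by simp only [h, mul_zero]) fun h => ?_
    simp only [h]
    rw [Pi.mul_apply, sign_mul, ← mul_assoc, ← sign_mul, sign_pos (mul_self_pos.2 (he i)),
      one_mul]
  · ext v
    simp [slopeForm_apply, mul_assoc, mul_left_comm]

theorem IsAdmissible.rescale {e : ι → ℝ} (he : ∀ i, e i ≠ 0)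
    (hψ : IsAdmissible (rescaleSlopes e s) ψ) : IsAdmissible s fun y => ψ (e * y) where
  contDiff := hψ.contDiff.comp (contDiff_const.mul contDiff_id)
  pos_zero := by simpa using hψ.pos_zero
  hasSlopeAt y hy := (hψ.hasSlopeAt _ hy).rescale he

end Slopes

section Planar

/-- The vector with entry `a` at the index `i` and `b` at the other index. -/
def pairAt {α : Type*} (i : Fin 2) (a b : α) : Fin 2 → α := Function.update (fun _ => b) i a

variable {i j : Fin 2}

theorem forall_iff_of_ne (hij : i ≠ j) {P : Fin 2 → Prop} : (∀ k, P k) ↔ P i ∧ P j := by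
  refine ⟨fun h => ⟨h i, h j⟩, fun h k => ?_⟩
  obtain rfl | rfl : k = i ∨ k = j := by omega
  exacts [h.1, h.2]

theorem slopeForm_apply_of_ne (hij : i ≠ j) (g y : Fin 2 → ℝ) :
    slopeForm g y = g i * y i + g j * y j := by
  rw [slopeForm_apply, ← Finset.sum_pair (f := fun k => g k * y k) hij]
  congr 1
  ext k
  simpa using (forall_iff_of_ne hij (P := fun k => k = i ∨ k = j)).2 ⟨.inl rfl, .inr rfl⟩ k

theorem pairAt_left {α : Type*} (i : Fin 2) (a b : α) : pairAt i a b i = a :=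
  Function.update_self ..

theorem pairAt_right {α : Type*} (hij : i ≠ j) (a b : α) : pairAt i a b j = b :=
  Function.update_of_ne hij.symm ..

theorem pairAt_apply_apply (hij : i ≠ j) {α : Type*} (g : Fin 2 → α) : pairAt i (g i) (g j) = g :=
  funext <| (forall_iff_of_ne hij).2 ⟨pairAt_left .., pairAt_right hij ..⟩

theorem isFace_pairAt (hij : i ≠ j) {a b : SignType} {y : Fin 2 → ℝ}
    (ha : a = 0 ∨ SignType.sign (y i) = a) (hb : b = 0 ∨ SignType.sign (y j) = b) :
    IsFace (pairAt i a b) fun k => SignType.sign (y k) := by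
  rw [IsFace, forall_iff_of_ne hij, pairAt_left, pairAt_right hij]
  exact ⟨ha.imp_right Eq.symm, hb.imp_right Eq.symm⟩

theorem isBounded_of_lt_add (hij : i ≠ j) {S : Set (Fin 2 → ℝ)} {a b : ℝ} (ha : a ≠ 0) (hb : b ≠ 0)
    (r c : ℝ) (hS : ∀ y ∈ S, a * y i ≤ r ∧ b * y j ≤ r ∧ c < a * y i + b * y j) :
    Bornology.IsBounded S := by
  refine (isBounded_of_lt_slopeForm (g := pairAt i a b) ?_ r c).subset fun y hy => ?_
  · rw [forall_iff_of_ne hij, pairAt_left, pairAt_right hij]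
    exact ⟨ha, hb⟩
  · rw [mem_ofPred_eq, forall_iff_of_ne hij, slopeForm_apply_of_ne hij, pairAt_left,
      pairAt_right hij, and_assoc]
    exact hS y hy

variable {s : (Fin 2 → SignType) → Fin 2 → ℝ}

theorem IsInward.neg (hs : IsInward s) {τ : Fin 2 → SignType} {k : Fin 2} (h : τ k = 1) :
    s τ k < 0 := by
  rw [← sign_eq_neg_one_iff, hs.sign_eq_neg τ k (by simp [h]), h]

theorem IsInward.pos (hs : IsInward s) {τ : Fin 2 → SignType} {k : Fin 2} (h : τ k = -1) :
    0 < s τ k := by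
  rw [← sign_eq_one_iff, hs.sign_eq_neg τ k (by simp [h]), h, neg_neg]

theorem isBounded_not_hasSlopeAt_smin (hij : i ≠ j) (hs : IsInward s)
    (hi : 0 < s 0 i) (hj : 0 < s 0 j)
    (hright : 0 < s (pairAt i 1 0) j) (hup : 0 < s (pairAt j 1 0) i) :
    Bornology.IsBounded {y | -1 < slopeForm (s 0) y ∧ ¬HasSlopeAt s
      (fun y => smin (slopeForm (s (pairAt i 1 0)) y) (slopeForm (s (pairAt j 1 0)) y)) y} := by
  set a := s (pairAt i 1 0)
  set b := s (pairAt j 1 0)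
  have hai : a i < 0 := hs.neg (pairAt_left ..)
  have hbj : b j < 0 := hs.neg (pairAt_left ..)
  have hlow : Bornology.IsBounded {y | y i ≤ 0 ∧ y j ≤ 0 ∧ -1 < slopeForm (s 0) y} := by
    refine isBounded_of_lt_add hij hi.ne' hj.ne' 0 (-1) fun y ⟨hyi, hyj, hlt⟩ => ?_
    rw [slopeForm_apply_of_ne hij] at hlt
    exact ⟨by nlinarith, by nlinarith, hlt⟩
  have hhigh : Bornology.IsBounded
      {y : Fin 2 → ℝ | y i ≤ 0 ∧ 0 ≤ y j ∧ -1 < (b i - a i) * y i + (b j - a j) * y j} :=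
    isBounded_of_lt_add hij (by linarith) (by linarith) 0 (-1) fun y ⟨hyi, hyj, hlt⟩ =>
      ⟨by nlinarith, by nlinarith, hlt⟩
  refine (hlow.union hhigh).subset fun y ⟨hp, hy⟩ => ?_
  by_contra hcon
  refine hy ?_
  have ha : 0 < y i → HasSlopeAt s (slopeForm a) y := fun hy =>
    hasSlopeAt_slopeForm (isFace_pairAt hij (.inr (sign_pos hy)) (.inl rfl))
  have hb : 0 < y j → HasSlopeAt s (slopeForm b) y := fun hy =>
    hasSlopeAt_slopeForm (isFace_pairAt hij.symm (.inr (sign_pos hy)) (.inl rfl))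
  rcases lt_or_ge 0 (y i) with hyi | hyi <;> rcases lt_or_ge 0 (y j) with hyj | hyj
  · exact hasSlopeAt_smin (ha hyi) (hb hyj)
  · refine hasSlopeAt_smin_of_le (ha hyi) (slopeForm b).differentiableAt ?_
    rw [slopeForm_apply_of_ne hij, slopeForm_apply_of_ne hij]
    nlinarith
  · refine hasSlopeAt_smin_of_add_one_le (slopeForm a).differentiableAt (hb hyj) ?_
    rw [slopeForm_apply_of_ne hij, slopeForm_apply_of_ne hij]
    have : ¬-1 < (b i - a i) * y i + (b j - a j) * y j := fun h => hcon (.inr ⟨hyi, hyj.le, h⟩)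
    linarith
  · exact absurd (.inl ⟨hyi, hyj, hp⟩) hcon

theorem exists_isAdmissible_isBounded_of_pos_of_pos (hij : i ≠ j) (hs : IsInward s)
    (hi : 0 < s 0 i) (hj : 0 < s 0 j)
    (hright : 0 < s (pairAt i 1 0) j) (hup : 0 < s (pairAt j 1 0) i) :
    ∃ ψ, IsAdmissible s ψ ∧ Bornology.IsBounded {y | 0 < ψ y} := by
  set a := s (pairAt i 1 0)
  set b := s (pairAt j 1 0)
  have hai : a i < 0 := hs.neg (pairAt_left ..)
  have hbj : b j < 0 := hs.neg (pairAt_left ..)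
  obtain ⟨c, ψ, hψ, hcut⟩ := (IsAdmissible.one_add_slopeForm s).exists_cut
    (contDiff_smin (slopeForm a).contDiff (slopeForm b).contDiff)
    ((isBounded_not_hasSlopeAt_smin hij hs hi hj hright hup).subset fun y hy =>
      ⟨by linarith [hy.1], hy.2⟩)
  have hpos : ∀ y, 0 < ψ y → -1 < s 0 i * y i + s 0 j * y j ∧
      c - 1 / 2 < a i * y i + a j * y j ∧ c - 1 / 2 < b i * y i + b j * y j := by
    intro y hy
    obtain ⟨hp, hc⟩ := hcut y hy
    have := smin_le_left (slopeForm a y) (slopeForm b y)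
    have := smin_le_right (slopeForm a y) (slopeForm b y)
    simp only [← slopeForm_apply_of_ne hij]
    refine ⟨?_, ?_, ?_⟩ <;> linarith
  have hthird : Bornology.IsBounded {y | 0 < ψ y ∧ y i ≤ 0 ∧ y j ≤ 0} :=
    isBounded_of_lt_add hij hi.ne' hj.ne' 0 (-1) fun y ⟨hy, hyi, hyj⟩ =>
      ⟨by nlinarith, by nlinarith, (hpos y hy).1⟩
  have hfourth : Bornology.IsBounded {y | 0 < ψ y ∧ 0 ≤ y i ∧ y j ≤ 0} :=
    isBounded_of_lt_add hij hai.ne hright.ne' 0 (c - 1 / 2) fun y ⟨hy, hyi, hyj⟩ =>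
      ⟨by nlinarith, by nlinarith, (hpos y hy).2.1⟩
  have hsecond : Bornology.IsBounded {y | 0 < ψ y ∧ y i ≤ 0 ∧ 0 ≤ y j} :=
    isBounded_of_lt_add hij hup.ne' hbj.ne 0 (c - 1 / 2) fun y ⟨hy, hyi, hyj⟩ =>
      ⟨by nlinarith, by nlinarith, (hpos y hy).2.2⟩
  refine hψ.exists_isBounded hs (τ := pairAt i 1 1) ?_ <|
    (hthird.union (hfourth.union hsecond)).subset fun y ⟨hy, hface⟩ => ?_
  · rw [forall_iff_of_ne hij, pairAt_left, pairAt_right hij]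
    decide
  · rcases lt_or_ge 0 (y i) with hyi | hyi <;> rcases lt_or_ge 0 (y j) with hyj | hyj
    · exact absurd (isFace_pairAt hij (.inr (sign_pos hyi)) (.inr (sign_pos hyj))) hface
    · exact .inr (.inl ⟨hy, hyi.le, hyj⟩)
    · exact .inr (.inr ⟨hy, hyi, hyj.le⟩)
    · exact .inl ⟨hy, hyi, hyj⟩

/-- The `C¹` function on the line whose derivative is `γ` on `t ≤ -1`, `β` at `0` and `α` on
`1 ≤ t`, and interpolates linearly in between. -/
noncomputable def bend (α β γ t : ℝ) : ℝ :=
  β * t + (α - β) * ramp t - (γ - β) * ramp (-t)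

theorem contDiff_bend (α β γ : ℝ) : ContDiff ℝ 1 (bend α β γ) :=
  ((contDiff_const.mul contDiff_id).add (contDiff_const.mul contDiff_ramp)).sub
    (contDiff_const.mul (contDiff_ramp.comp contDiff_neg))

theorem hasDerivAt_bend (α β γ t : ℝ) : HasDerivAt (bend α β γ)
    (β + (α - β) * deriv ramp t + (γ - β) * deriv ramp (-t)) t := by
  refine ((((hasDerivAt_id t).const_mul β).add ((hasDerivAt_deriv_ramp t).const_mul (α - β))).sub
    (((hasDerivAt_deriv_ramp (-t)).comp t (hasDerivAt_neg t)).const_mul (γ - β))).congr_deriv ?_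
  ring

theorem deriv_bend_mem_segment_of_nonneg (α β γ : ℝ) {t : ℝ} (ht : 0 ≤ t) :
    deriv (bend α β γ) t ∈ segment ℝ β α := by
  rw [(hasDerivAt_bend α β γ t).deriv, deriv_ramp_of_nonpos (neg_nonpos.2 ht),
    segment_eq_image_lineMap]
  exact ⟨deriv ramp t, deriv_ramp_mem_Icc t, by rw [AffineMap.lineMap_apply_ring']; ring⟩

theorem deriv_bend_mem_segment_of_nonpos (α β γ : ℝ) {t : ℝ} (ht : t ≤ 0) :
    deriv (bend α β γ) t ∈ segment ℝ β γ := by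
  rw [(hasDerivAt_bend α β γ t).deriv, deriv_ramp_of_nonpos ht, segment_eq_image_lineMap]
  exact ⟨deriv ramp (-t), deriv_ramp_mem_Icc _, by rw [AffineMap.lineMap_apply_ring']; ring⟩

theorem deriv_bend_zero (α β γ : ℝ) : deriv (bend α β γ) 0 = β := by
  rw [(hasDerivAt_bend α β γ 0).deriv, neg_zero, deriv_ramp_of_nonpos le_rfl]
  ring

theorem deriv_bend_of_one_le (α β γ : ℝ) {t : ℝ} (ht : 1 ≤ t) : deriv (bend α β γ) t = α := by
  rw [(hasDerivAt_bend α β γ t).deriv, deriv_ramp_of_one_le ht, deriv_ramp_of_nonpos (by linarith)]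
  ring

theorem bend_le_of_nonpos (α β γ : ℝ) {t : ℝ} (ht : t ≤ 0) :
    bend α β γ t ≤ γ * t + |γ - β| := by
  have h₁ := ramp_le (neg_nonneg.2 ht)
  have h₂ := sub_half_le_ramp (-t)
  have h := neg_abs_le (γ - β)
  have h' := le_abs_self (γ - β)
  rw [bend, ramp_of_nonpos ht]
  nlinarith

theorem exists_pairAt_mem_segment (hij : i ≠ j) {p q : Fin 2 → ℝ} {t : ℝ} (hq : q j ≤ t)
    (hp : t ≤ p j) : ∃ x, pairAt i x t ∈ segment ℝ p q := by
  have ht : t ∈ (LinearMap.proj j : (Fin 2 → ℝ) →ₗ[ℝ] ℝ) '' segment ℝ p q := by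
    rw [← LinearMap.coe_toAffineMap, image_segment, segment_eq_uIcc]
    exact mem_uIcc_of_ge hq hp
  obtain ⟨g, hg, rfl⟩ := ht
  exact ⟨g i, by rwa [LinearMap.proj_apply, pairAt_apply_apply hij]⟩

theorem exists_pairAt_neg_mem_segment (hij : i ≠ j) (hs : IsInward s) (hi : 0 < s 0 i)
    (hj : 0 < s 0 j) (hright : s (pairAt i 1 0) j < 0) : ∃ k > 0, ∃ α β γ, 0 < γ ∧
      pairAt i α (-k) ∈ segment ℝ (s 0) (s (pairAt i 1 0)) ∧
      pairAt i β (-k) ∈ segment ℝ (s 0) (s (pairAt i 0 1)) ∧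
      pairAt i γ (-k) ∈ segment ℝ (s 0) (s (pairAt i (-1) 1)) := by
  obtain ⟨k, hk, hk'⟩ : ∃ k > 0, k ≤ -s (pairAt i 1 0) j ∧ k ≤ -s (pairAt i 0 1) j ∧
      k ≤ -s (pairAt i (-1) 1) j := by
    have h₁ : s (pairAt i 0 1) j < 0 := hs.neg (pairAt_right hij ..)
    have h₂ : s (pairAt i (-1) 1) j < 0 := hs.neg (pairAt_right hij ..)
    simp_rw [← le_min_iff]
    exact ⟨_, lt_min (neg_pos.2 hright) (lt_min (neg_pos.2 h₁) (neg_pos.2 h₂)), le_rfl⟩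
  obtain ⟨α, hα⟩ := exists_pairAt_mem_segment hij (le_neg.1 hk'.1) ((neg_lt_zero.2 hk).trans hj).le
  obtain ⟨β, hβ⟩ := exists_pairAt_mem_segment hij (le_neg.1 hk'.2.1)
    ((neg_lt_zero.2 hk).trans hj).le
  obtain ⟨γ, hγ⟩ := exists_pairAt_mem_segment hij (le_neg.1 hk'.2.2)
    ((neg_lt_zero.2 hk).trans hj).le
  have hpos : pairAt i γ (-k) ∈ {g : Fin 2 → ℝ | 0 < g i} :=
    (convex_halfSpace_gt (LinearMap.proj i : (Fin 2 → ℝ) →ₗ[ℝ] ℝ).isLinear 0).segment_subset hi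
      (hs.pos (pairAt_left ..)) hγ
  rw [mem_ofPred_eq, pairAt_left] at hpos
  exact ⟨k, hk, α, β, γ, hpos, hα, hβ, hγ⟩

theorem hasFDerivAt_bend_sub (hij : i ≠ j) (α β γ k : ℝ) (y : Fin 2 → ℝ) :
    HasFDerivAt (fun y : Fin 2 → ℝ => bend α β γ (y i) - k * y j)
      (slopeForm (pairAt i (deriv (bend α β γ) (y i)) (-k))) y := by
  have hproj (l : Fin 2) : HasFDerivAt (fun y : Fin 2 → ℝ => y l) (.proj l) y :=
    (ContinuousLinearMap.proj (R := ℝ) (φ := fun _ : Fin 2 => ℝ) l).hasFDerivAt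
  have hbend := (hasDerivAt_bend α β γ (y i)).differentiableAt.hasDerivAt.comp_hasFDerivAt y
    (hproj i)
  refine (hbend.sub ((hproj j).const_mul k)).congr_fderiv ?_
  ext v
  simp [slopeForm_apply_of_ne hij, pairAt_left, pairAt_right hij, sub_eq_add_neg]

theorem hasSlopeAt_bend_sub (hij : i ≠ j) {α β γ k : ℝ}
    (hα : pairAt i α (-k) ∈ segment ℝ (s 0) (s (pairAt i 1 0)))
    (hβ : pairAt i β (-k) ∈ segment ℝ (s 0) (s (pairAt i 0 1)))
    (hγ : pairAt i γ (-k) ∈ segment ℝ (s 0) (s (pairAt i (-1) 1))) {y : Fin 2 → ℝ}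
    (hy : 0 < y j ∨ 1 ≤ y i) :
    HasSlopeAt s (fun y => bend α β γ (y i) - k * y j) y := by
  refine ⟨_, ?_, hasFDerivAt_bend_sub hij α β γ k y⟩
  set σ : Fin 2 → SignType := fun i => SignType.sign (y i)
  have hzero : IsFace 0 σ := fun _ => .inl rfl
  have hright : 0 < y i → pairAt i α (-k) ∈ slopeHull s σ := fun hyi =>
    segment_subset_slopeHull s hzero (isFace_pairAt hij (.inr (sign_pos hyi)) (.inl rfl)) hα
  have hup : 0 < y j → pairAt i β (-k) ∈ slopeHull s σ := fun hyj =>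
    segment_subset_slopeHull s hzero (isFace_pairAt hij (.inl rfl) (.inr (sign_pos hyj))) hβ
  have hsecond : y i < 0 → 0 < y j → pairAt i γ (-k) ∈ slopeHull s σ := fun hyi hyj =>
    segment_subset_slopeHull s hzero
      (isFace_pairAt hij (.inr (sign_neg hyi)) (.inr (sign_pos hyj))) hγ
  have hconvex : Convex ℝ {x : ℝ | pairAt i x (-k) ∈ slopeHull s σ} := by
    intro x hx x' hx' a b ha hb hab
    have hcomb : pairAt i (a • x + b • x') (-k) = a • pairAt i x (-k) + b • pairAt i x' (-k) :=
      funext <| (forall_iff_of_ne hij).2 ⟨by simp [pairAt_left], by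
        simp [pairAt_right hij, ← neg_add, ← add_mul, hab]⟩
    rw [mem_ofPred_eq, hcomb]
    exact convex_convexHull ℝ _ hx hx' ha hb hab
  rcases le_or_gt 1 (y i) with hyi | hyi
  · rw [deriv_bend_of_one_le α β γ hyi]
    exact hright (by linarith)
  have hyj := hy.resolve_right hyi.not_ge
  rcases lt_trichotomy (y i) 0 with hyi | hyi | hyi
  · exact hconvex.segment_subset (hup hyj) (hsecond hyi hyj)
      (deriv_bend_mem_segment_of_nonpos α β γ hyi.le)
  · rw [hyi, deriv_bend_zero]
    exact hup hyj
  · exact hconvex.segment_subset (hup hyj) (hright hyi)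
      (deriv_bend_mem_segment_of_nonneg α β γ hyi.le)

theorem exists_isAdmissible_isBounded_of_pos_of_neg (hij : i ≠ j) (hs : IsInward s)
    (hi : 0 < s 0 i) (hj : 0 < s 0 j) (hright : s (pairAt i 1 0) j < 0) :
    ∃ ψ, IsAdmissible s ψ ∧ Bornology.IsBounded {y | 0 < ψ y} := by
  obtain ⟨k, hk, α, β, γ, hγpos, hα, hβ, hγ⟩ :=
    exists_pairAt_neg_mem_segment hij hs hi hj hright
  have hlow : Bornology.IsBounded
      {y | 0 < 1 + slopeForm (s 0) y ∧ y i ≤ 1 ∧ y j ≤ 0} := by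
    refine isBounded_of_lt_add hij hi.ne' hj.ne' (s 0 i) (-1) fun y ⟨hy, hyi, hyj⟩ => ?_
    rw [slopeForm_apply_of_ne hij] at hy
    exact ⟨by nlinarith, by nlinarith, by linarith⟩
  obtain ⟨c, ψ, hψ, hpos⟩ := (IsAdmissible.one_add_slopeForm s).exists_cut
    (h := fun y => bend α β γ (y i) - k * y j)
    (((contDiff_bend α β γ).comp (contDiff_apply ℝ ℝ i)).sub
      (contDiff_const.mul (contDiff_apply ℝ ℝ j))) <|
    hlow.subset fun y ⟨hy, hslope⟩ => ⟨hy, le_of_not_ge fun hyi => hslope <|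
      hasSlopeAt_bend_sub hij hα hβ hγ (.inr hyi), le_of_not_gt fun hyj => hslope <|
      hasSlopeAt_bend_sub hij hα hβ hγ (.inl hyj)⟩
  have hhigh : Bornology.IsBounded {y | 0 < ψ y ∧ y i ≤ 0 ∧ 0 ≤ y j} :=
    isBounded_of_lt_add hij hγpos.ne' (neg_ne_zero.2 hk.ne') 0 (c - |γ - β|)
      fun y ⟨hy, hyi, hyj⟩ => ⟨by nlinarith, by nlinarith, by
        linarith [(hpos y hy).2, bend_le_of_nonpos α β γ hyi]⟩
  have hleft : Bornology.IsBounded {y | 0 < ψ y ∧ y i ≤ 0} :=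
    (hlow.union hhigh).subset fun y ⟨hy, hyi⟩ => (le_total (y j) 0).imp
      (fun hyj => ⟨(hpos y hy).1, hyi.trans zero_le_one, hyj⟩) fun hyj => ⟨hy, hyi, hyj⟩
  obtain ⟨c', ψ', hψ', hpos'⟩ := hψ.exists_cut_slope (pairAt i 1 0) <|
    hleft.subset fun y ⟨hy, hface⟩ => ⟨hy, le_of_not_gt fun hyi => hface <|
      isFace_pairAt hij (.inr (sign_pos hyi)) (.inl rfl)⟩
  have hfirst : Bornology.IsBounded {y | 0 < ψ' y ∧ 0 ≤ y i ∧ 0 ≤ y j} := by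
    have hneg := hs.neg (pairAt_left i 1 0)
    refine isBounded_of_lt_add hij hneg.ne hright.ne 0 c' fun y ⟨hy, hyi, hyj⟩ => ?_
    rw [← slopeForm_apply_of_ne hij]
    exact ⟨by nlinarith, by nlinarith, (hpos' y hy).2⟩
  refine hψ'.exists_isBounded hs (τ := pairAt i 1 (-1)) ?_ <|
    (hleft.union hfirst).subset fun y ⟨hy, hface⟩ => ?_
  · rw [forall_iff_of_ne hij, pairAt_left, pairAt_right hij]
    decide
  · rcases le_or_gt (y i) 0 with hyi | hyi
    · exact .inl ⟨(hpos' y hy).1, hyi⟩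
    · exact .inr ⟨hy, hyi.le, le_of_not_gt fun hyj => hface <|
        isFace_pairAt hij (.inr (sign_pos hyi)) (.inr (sign_neg hyj))⟩

theorem IsInward.exists_isAdmissible_isBounded_of_pos (hs : IsInward s) (hpos : ∀ i, 0 < s 0 i) :
    ∃ ψ, IsAdmissible s ψ ∧ Bornology.IsBounded {y | 0 < ψ y} := by
  have h01 : (0 : Fin 2) ≠ 1 := by decide
  rcases (hs.ne_zero (pairAt 0 1 0) 1).lt_or_gt with hright | hright
  · exact exists_isAdmissible_isBounded_of_pos_of_neg h01 hs (hpos 0) (hpos 1) hright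
  rcases (hs.ne_zero (pairAt 1 1 0) 0).lt_or_gt with hup | hup
  · exact exists_isAdmissible_isBounded_of_pos_of_neg h01.symm hs (hpos 1) (hpos 0) hup
  · exact exists_isAdmissible_isBounded_of_pos_of_pos h01 hs (hpos 0) (hpos 1) hright hup

theorem IsInward.exists_isAdmissible_isBounded (hs : IsInward s) :
    ∃ ψ, IsAdmissible s ψ ∧ Bornology.IsBounded {y | 0 < ψ y} := by
  have hne : ∀ i, s 0 i ≠ 0 := hs.ne_zero 0
  obtain ⟨ψ, hψ, hbdd⟩ := (hs.rescale hne).exists_isAdmissible_isBounded_of_pos fun i => by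
    simp [rescaleSlopes, ← Pi.zero_def, hne i]
  refine ⟨_, hψ.rescale hne, ?_⟩
  refine ((ContinuousLinearMap.mul ℝ (Fin 2 → ℝ) (s 0)⁻¹).lipschitz.isBounded_image hbdd).subset
    fun y hy => ⟨s 0 * y, hy, funext fun i => inv_mul_cancel_left₀ (hne i) _⟩

end Planar

/-! ### Multipliers for sign constraints -/

section Multipliers

variable {ι : Type*}

/-- The closed orthant of the `y` with `y i ≥ 0` if `τ i = 1`, `y i ≤ 0` if `τ i = -1` and `y i = 0`
if `τ i = 0`; these three conditions all read `τ i * y i = |y i|`. -/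
noncomputable def closedOrthant (τ : ι → SignType) : ProperCone ℝ (ι → ℝ) where
  carrier := {y | ∀ i, τ i * y i = |y i|}
  zero_mem' := by simp
  add_mem' {x y} hx hy i := by
    refine le_antisymm ?_ ?_
    · calc (τ i : ℝ) * (x i + y i)
          ≤ |(τ i : ℝ)| * |x i + y i| := (le_abs_self _).trans_eq (abs_mul _ _)
        _ ≤ 1 * |x i + y i| := by gcongr; rcases τ i with _ | _ | _ <;> simp
        _ = |x i + y i| := one_mul _
    · calc |x i + y i| ≤ |x i| + |y i| := abs_add_le _ _
        _ = τ i * (x i + y i) := by rw [← hx i, ← hy i, mul_add]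
  smul_mem' c y hy i := by
    change (τ i : ℝ) * (c * y i) = |c * y i|
    rw [abs_mul, abs_of_nonneg c.2, ← hy i, mul_left_comm]
  isClosed' := by
    simp only [ofPred_forall]
    exact isClosed_iInter fun i => isClosed_eq (by fun_prop) (by fun_prop)

theorem single_mem_closedOrthant [DecidableEq ι] (τ : ι → SignType) (i : ι) :
    Pi.single i (τ i : ℝ) ∈ closedOrthant τ := by
  intro j
  rcases eq_or_ne j i with rfl | h
  · rcases τ j with _ | _ | _ <;> simp
  · simp [h]

theorem sign_add_mul_of_mul_eq_abs {τ : SignType} {y ε : ℝ} (h : τ * y = |y|) (hε : 0 < ε) :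
    SignType.sign (y + ε * τ) = τ := by
  rcases τ with _ | _ | _
  · simp_all [eq_comm (a := (0 : ℝ))]
  · simp only [SignType.neg_eq_neg_one, SignType.coe_neg_one] at h ⊢
    exact sign_neg (by linarith [abs_nonneg y])
  · simp only [SignType.pos_eq_one, SignType.coe_one] at h ⊢
    exact sign_pos (by linarith [abs_nonneg y])

theorem exists_sign_add_mul (τ : SignType) {x : ℝ} (h : 0 ≤ τ * x) :
    ∃ e : ℝ, ∀ κ > 0, x + κ * e ≠ 0 ∧ (τ ≠ 0 → SignType.sign (x + κ * e) = τ) := by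
  rcases τ with _ | _ | _
  · rcases le_total 0 x with hx | hx
    · exact ⟨1, fun κ hκ => ⟨by linarith, by simp⟩⟩
    · exact ⟨-1, fun κ hκ => ⟨by linarith, by simp⟩⟩
  · simp only [SignType.neg_eq_neg_one, SignType.coe_neg_one] at h
    have hneg : ∀ κ > 0, x + κ * -1 < 0 := fun κ hκ => by linarith
    exact ⟨-1, fun κ hκ => ⟨(hneg κ hκ).ne, fun _ => sign_neg (hneg κ hκ)⟩⟩
  · simp only [SignType.pos_eq_one, SignType.coe_one] at h
    have hpos : ∀ κ > 0, 0 < x + κ * 1 := fun κ hκ => by linarith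
    exact ⟨1, fun κ hκ => ⟨(hpos κ hκ).ne', fun _ => sign_pos (hpos κ hκ)⟩⟩

variable [Fintype ι]

theorem exists_slopeForm_neg_of_disjoint {K : Set (ι → ℝ)} (hK : IsCompact K) (hKc : Convex ℝ K)
    {τ : ι → SignType} (hdisj : Disjoint K (closedOrthant τ)) :
    ∃ g : ι → ℝ, (∀ i, 0 ≤ τ i * g i) ∧ ∀ y ∈ K, slopeForm g y < 0 := by
  classical
  obtain ⟨f, hf, hfK⟩ := (closedOrthant τ).hyperplane_separation hKc hK hdisj
  have hsingle (i : ι) (t : ℝ) : f (Pi.single i t) = t * f (Pi.single i 1) := by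
    rw [← smul_eq_mul, ← map_smul, ← Pi.single_smul, smul_eq_mul, mul_one]
  refine ⟨fun i => f (Pi.single i 1), fun i => ?_, fun y hy => ?_⟩
  · exact hsingle i (τ i) ▸ hf _ (single_mem_closedOrthant τ i)
  · calc slopeForm (fun i => f (Pi.single i 1)) y = ∑ i, f (Pi.single i (y i)) := by
          rw [slopeForm_apply]
          exact Finset.sum_congr rfl fun i _ => ((hsingle i _).trans (mul_comm _ _)).symm
      _ = f y := by rw [← map_sum, Finset.univ_sum_single]
      _ < 0 := hfK y hy

theorem exists_slopeForm_neg_of_disjoint_of_ne_zero {K : Set (ι → ℝ)} (hK : IsCompact K)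
    (hKc : Convex ℝ K) {τ : ι → SignType} (hdisj : Disjoint K (closedOrthant τ)) :
    ∃ g : ι → ℝ, (∀ i, g i ≠ 0) ∧ (∀ i, τ i ≠ 0 → SignType.sign (g i) = τ i) ∧
      ∀ y ∈ K, slopeForm g y < 0 := by
  obtain ⟨g, hg, hneg⟩ := exists_slopeForm_neg_of_disjoint hK hKc hdisj
  choose e he using fun i => exists_sign_add_mul (τ i) (hg i)
  have hcont : Continuous fun p : ℝ × (ι → ℝ) => slopeForm (fun i => g i + p.1 * e i) p.2 := by
    simp only [slopeForm_apply]
    fun_prop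
  have hev : ∀ᶠ κ in 𝓝 (0 : ℝ), ∀ y ∈ K, slopeForm (fun i => g i + κ * e i) y < 0 :=
    hK.eventually_forall_of_forall_eventually fun y hy =>
      hcont.continuousAt.eventually_lt_const (by simpa using hneg y hy)
  obtain ⟨κ, hκ, hκ0⟩ := ((hev.filter_mono nhdsWithin_le_nhds).and self_mem_nhdsWithin :
    ∀ᶠ κ in 𝓝[>] (0 : ℝ), _).exists
  exact ⟨_, fun i => (he i κ hκ0).1, fun i => (he i κ hκ0).2, hκ⟩

theorem exists_multiplier {V : Type*} [NormedAddCommGroup V] [NormedSpace ℝ V] {K : Set V}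
    (hK : IsCompact K) (hKc : Convex ℝ K) (E : V →L[ℝ] ℝ) (l : V →L[ℝ] ι → ℝ) {c : ℝ}
    {τ : ι → SignType} (hlt : ∀ z ∈ K, l z ∈ closedOrthant τ → c < E z) :
    ∃ g : ι → ℝ, (∀ i, g i ≠ 0) ∧ (∀ i, τ i ≠ 0 → SignType.sign (g i) = -τ i) ∧
      ∀ z ∈ K, c < E z + slopeForm g (l z) := by
  let L : V → Option ι → ℝ := fun z o => o.elim (c - E z) (l z)
  let σ : Option ι → SignType := fun o => o.elim 1 τ
  have hL : Continuous L := continuous_pi (Option.rec (continuous_const.sub E.continuous)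
    fun i => (continuous_apply i).comp l.continuous)
  have hLK : Convex ℝ (L '' K) := by
    rintro _ ⟨x, hx, rfl⟩ _ ⟨y, hy, rfl⟩ a b ha hb hab
    refine ⟨a • x + b • y, hKc hx hy ha hb hab, funext (Option.rec ?_ fun i => ?_)⟩
    · simp only [L, Option.elim, map_add, map_smul, smul_eq_mul, Pi.add_apply, Pi.smul_apply]
      linear_combination (-c) * hab
    · simp [L]
  have hdisj : Disjoint (L '' K) (closedOrthant σ) := by
    refine disjoint_left.2 (forall_mem_image.2 fun z hz hLz => ?_)
    have hnone : ((1 : SignType) : ℝ) * (c - E z) = |c - E z| := hLz none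
    rw [SignType.coe_one] at hnone
    linarith [hlt z hz fun i => hLz (some i), abs_nonneg (c - E z)]
  obtain ⟨g, hg0, hgsign, hneg⟩ :=
    exists_slopeForm_neg_of_disjoint_of_ne_zero (hK.image hL) hLK hdisj
  have hnone : 0 < g none := sign_eq_one_iff.1 (hgsign none one_ne_zero)
  refine ⟨fun i => -(g none)⁻¹ * g (some i), fun i => ?_, fun i hi => ?_, fun z hz => ?_⟩
  · exact mul_ne_zero (neg_ne_zero.2 (inv_ne_zero hnone.ne')) (hg0 _)
  · rw [sign_mul, sign_neg (neg_neg_of_pos (inv_pos.2 hnone)), neg_one_mul]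
    exact congrArg _ (hgsign (some i) hi)
  · have hneg : slopeForm g (L z) < 0 := hneg _ (mem_image_of_mem L hz)
    rw [slopeForm_apply, Fintype.sum_option] at hneg
    have hlt : (g none)⁻¹ * ∑ i, g (some i) * l z i < E z - c :=
      (inv_mul_lt_iff₀ hnone).2 (by simp only [L, Option.elim] at hneg; linarith)
    simp only [slopeForm_apply, neg_mul, mul_assoc, Finset.sum_neg_distrib, ← Finset.mul_sum]
    linarith

end Multipliers

theorem eventually_forall_mem_of_upperHemicontinuousAt {X Y : Type*} [TopologicalSpace X]
    [TopologicalSpace Y] {Φ : X → Set Y} {x₀ : X} (hΦ : UpperHemicontinuousAt Φ x₀)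
    (hcomp : IsCompact (Φ x₀)) {P : X → Y → Prop}
    (hP : ∀ y ∈ Φ x₀, ∀ᶠ p : X × Y in 𝓝 (x₀, y), P p.1 p.2) :
    ∀ᶠ x in 𝓝 x₀, ∀ y ∈ Φ x, P x y := by
  have hP' : ∀ᶠ p : X × Y in 𝓝ˢ ({x₀} ×ˢ Φ x₀), P p.1 p.2 :=
    mem_nhdsSet_iff_forall.2 fun ⟨_, y⟩ ⟨hx, hy⟩ => by obtain rfl := hx; exact hP y hy
  rw [isCompact_singleton.nhdsSet_prod_eq hcomp, nhdsSet_singleton] at hP'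
  obtain ⟨U, hU, t, ht, hUt⟩ := mem_prod_iff.1 hP'
  filter_upwards [hU, upperHemicontinuousAt_iff.1 hΦ t ht] with x hx hxt y hy
  exact hUt (mk_mem_prod hx (subset_of_mem_nhdsSet hxt hy))

theorem exists_isLocalMin_sub_of_sq_dist_le {X : Type*} [PseudoMetricSpace X] [ProperSpace X]
    {w θ : X → ℝ} {z₀ : X} {r : ℝ} (hr : 0 ≤ r)
    (hw : ∀ z ∈ Metric.closedBall z₀ r, w z₀ + dist z z₀ ^ 2 ≤ w z)
    (hlsc : LowerSemicontinuousOn (fun z => w z - θ z) (Metric.closedBall z₀ r))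
    (hθ : ∀ z ∈ Metric.closedBall z₀ r, θ z < θ z₀ + r ^ 2) :
    ∃ z ∈ Metric.ball z₀ r, θ z₀ ≤ θ z ∧ IsLocalMin (fun z => w z - θ z) z := by
  obtain ⟨z, hz, hmin⟩ := hlsc.exists_isMinOn (Metric.nonempty_closedBall.2 hr)
    (isCompact_closedBall z₀ r)
  have hle : w z - θ z ≤ w z₀ - θ z₀ := hmin (Metric.mem_closedBall_self hr)
  have hball : z ∈ Metric.ball z₀ r :=
    lt_of_pow_lt_pow_left₀ 2 hr (by linarith [hw z hz, hθ z hz])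
  refine ⟨z, hball, by nlinarith [hw z hz], hmin.isLocalMin ?_⟩
  exact mem_of_superset (Metric.isOpen_ball.mem_nhds hball) Metric.ball_subset_closedBall

/-! ### Local structure of a multi-domain -/

theorem mem_tangentConeOf_of_eventually_mem {d : ℕ} {C : Set (Euc d)} {x v : Euc d}
    (h : ∀ᶠ t in 𝓝[>] (0 : ℝ), x + t • v ∈ C) : v ∈ tangentConeOf C x := by
  have hdist : (fun t : ℝ => Metric.infDist (x + t • v) C / t) =ᶠ[𝓝[>] 0] fun _ => 0 := by
    filter_upwards [h] with t ht
    rw [Metric.infDist_zero_of_mem ht, zero_div]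
  exact (liminf_congr hdist).trans (liminf_const 0)

namespace MultiDomain

variable {d : ℕ} (D : MultiDomain d)

theorem convex_face (σ : Fin D.q → SignType) : Convex ℝ (D.face σ) := by
  rw [face, ofPred_forall]
  refine convex_iInter fun j => ?_
  have hlin := (innerₗ (Euc d) (D.normal j)).isLinear
  rcases σ j with _ | _ | _
  · simpa [sign_eq_zero_iff, sub_eq_zero] using convex_hyperplane hlin (D.offset j)
  · simpa [sign_eq_neg_one_iff, sub_neg] using convex_halfSpace_lt hlin (D.offset j)
  · simpa [sign_eq_one_iff, sub_pos] using convex_halfSpace_gt hlin (D.offset j)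

theorem Ω_subset_face {i : Fin D.m} {σ : Fin D.q → SignType} (h : (D.Ω i ∩ D.face σ).Nonempty) :
    D.Ω i ⊆ D.face σ := by
  obtain ⟨x, hxΩ, hxσ⟩ := h
  intro y hy j
  rw [← hxσ j]
  refine (D.isConnected_Ω i).isPreconnected.constant
    (f := fun z => SignType.sign (inner ℝ (D.normal j) z - D.offset j)) (fun z hz => ?_) hy hxΩ
  refine ContinuousAt.continuousWithinAt (ContinuousAt.comp (g := SignType.sign)
    (continuousAt_sign_of_ne_zero fun hzj => ?_) (by fun_prop))
  exact (D.inter_eq_empty i).le ⟨mem_iUnion.2 ⟨j, sub_eq_zero.1 hzj⟩, hz⟩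

variable {D}

theorem face_subset_iUnion_Ω {σ : Fin D.q → SignType} (hσ : ∀ j, σ j ≠ 0) :
    D.face σ ⊆ ⋃ i, D.Ω i := by
  refine fun x hx => (D.cover.ge (mem_univ x)).resolve_left fun hmem => ?_
  obtain ⟨j, hj⟩ := mem_iUnion.1 hmem
  exact hσ j ((hx j).symm.trans (sign_eq_zero_iff.2 (sub_eq_zero.2 hj)))

theorem face_subset_Ω {i : Fin D.m} {σ : Fin D.q → SignType} (hσ : ∀ j, σ j ≠ 0)
    (h : (D.Ω i ∩ D.face σ).Nonempty) : D.face σ ⊆ D.Ω i := by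
  refine (D.convex_face σ).isPreconnected.subset_left_of_subset_union (D.isOpen_Ω i)
    (isOpen_biUnion fun k (_ : k ≠ i) => D.isOpen_Ω k) ?_ (fun y hy => ?_) (inter_comm _ _ ▸ h)
  · exact disjoint_iUnion₂_right.2 fun k hk => D.disjoint_Ω i k (Ne.symm hk)
  · obtain ⟨k, hk⟩ := mem_iUnion.1 (face_subset_iUnion_Ω hσ hy)
    rcases eq_or_ne k i with rfl | hki
    exacts [.inl hk, .inr (mem_biUnion hki hk)]

theorem face_mem_strata {σ : Fin D.q → SignType} (hne : (D.face σ).Nonempty) :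
    D.face σ ∈ D.strata := by
  by_cases hσ : ∃ j, σ j = 0
  · exact .inr ⟨hne, σ, hσ, rfl⟩
  · push Not at hσ
    obtain ⟨x, hx⟩ := hne
    obtain ⟨i, hi⟩ := mem_iUnion.1 (face_subset_iUnion_Ω hσ hx)
    exact .inl ⟨i, (D.Ω_subset_face ⟨x, hi, hx⟩).antisymm (face_subset_Ω hσ ⟨x, hi, hx⟩)⟩

variable (D)

open Classical in
/-- The normal of the hyperplanes of the `i`-th family through `x₀`, or `0` if there are none. -/
noncomputable def localNormal (x₀ : Euc d) (i : Fin 2) : Euc d :=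
  if h : ∃ j, D.family j = i ∧ inner ℝ (D.normal j) x₀ = D.offset j then D.normal h.choose else 0

/-- The components of a vector along the normals of the hyperplanes through `x₀`. -/
noncomputable def localCoord (x₀ : Euc d) : Euc d →L[ℝ] Fin 2 → ℝ :=
  .pi fun i => innerSL ℝ (D.localNormal x₀ i)

/-- A vector whose local coordinates have signs `τ`. -/
noncomputable def localDir (x₀ : Euc d) (τ : Fin 2 → SignType) : Euc d :=
  ∑ i, (τ i : ℝ) • D.localNormal x₀ i

open Classical in
/-- The face adjacent to `x₀` having prescribed positions with respect to the hyperplanes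
through `x₀`. -/
noncomputable def localFace (x₀ : Euc d) (τ : Fin 2 → SignType) : Set (Euc d) :=
  D.face fun j => if inner ℝ (D.normal j) x₀ = D.offset j then τ (D.family j)
    else SignType.sign (inner ℝ (D.normal j) x₀ - D.offset j)

variable {D} {x₀ : Euc d}

theorem localCoord_apply (w : Euc d) (i : Fin 2) :
    D.localCoord x₀ w i = inner ℝ (D.localNormal x₀ i) w :=
  rfl

theorem localNormal_family {j : Fin D.q} (h : inner ℝ (D.normal j) x₀ = D.offset j) :
    D.localNormal x₀ (D.family j) = D.normal j := by
  have hex : ∃ k, D.family k = D.family j ∧ inner ℝ (D.normal k) x₀ = D.offset k := ⟨j, rfl, h⟩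
  rw [localNormal, dif_pos hex]
  exact D.normal_eq _ _ hex.choose_spec.1

theorem exists_normal_eq_localNormal {i : Fin 2} (h : D.localNormal x₀ i ≠ 0) :
    ∃ j, D.family j = i ∧ D.normal j = D.localNormal x₀ i := by
  by_cases hex : ∃ j, D.family j = i ∧ inner ℝ (D.normal j) x₀ = D.offset j
  · exact ⟨hex.choose, hex.choose_spec.1, by rw [localNormal, dif_pos hex]⟩
  · exact absurd (dif_neg hex) h

theorem norm_localNormal {i : Fin 2} (h : D.localNormal x₀ i ≠ 0) :
    ‖D.localNormal x₀ i‖ = 1 := by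
  obtain ⟨j, -, hj⟩ := exists_normal_eq_localNormal h
  rw [← hj, D.norm_normal]

theorem inner_localNormal {i k : Fin 2} (hik : i ≠ k) :
    inner ℝ (D.localNormal x₀ i) (D.localNormal x₀ k) = 0 := by
  by_cases hi : D.localNormal x₀ i = 0
  · rw [hi, inner_zero_left]
  by_cases hk : D.localNormal x₀ k = 0
  · rw [hk, inner_zero_right]
  obtain ⟨j, rfl, hj⟩ := exists_normal_eq_localNormal hi
  obtain ⟨j', rfl, hj'⟩ := exists_normal_eq_localNormal hk
  rw [← hj, ← hj', D.normal_orthogonal _ _ hik]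

theorem localCoord_localDir (τ : Fin 2 → SignType) {i : Fin 2} (hi : D.localNormal x₀ i ≠ 0) :
    D.localCoord x₀ (D.localDir x₀ τ) i = τ i := by
  rw [localCoord_apply, localDir, inner_sum, Finset.sum_eq_single_of_mem i (Finset.mem_univ i)]
  · rw [inner_smul_right, real_inner_self_eq_norm_sq, norm_localNormal hi, one_pow, mul_one]
  · intro k _ hk
    rw [inner_smul_right, inner_localNormal hk.symm, mul_zero]

theorem localDir_mem_closedOrthant {τ σ : Fin 2 → SignType} (h : IsFace τ σ) :
    D.localCoord x₀ (D.localDir x₀ τ) ∈ closedOrthant σ := by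
  intro i
  by_cases hi : D.localNormal x₀ i = 0
  · rw [localCoord_apply, hi, inner_zero_left, mul_zero, abs_zero]
  · rw [localCoord_localDir τ hi]
    rcases h i with hτ | hτ <;> rw [hτ] <;> rcases σ i with _ | _ | _ <;> simp

variable (D x₀)

theorem eventually_sign_eq (j : Fin D.q) (hj : inner ℝ (D.normal j) x₀ ≠ D.offset j) :
    ∀ᶠ x in 𝓝 x₀, SignType.sign (inner ℝ (D.normal j) x - D.offset j) =
      SignType.sign (inner ℝ (D.normal j) x₀ - D.offset j) := by
  have hcont : ContinuousAt (fun x => SignType.sign (inner ℝ (D.normal j) x - D.offset j)) x₀ :=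
    ContinuousAt.comp (g := SignType.sign)
      (continuousAt_sign_of_ne_zero (sub_ne_zero.2 hj)) (by fun_prop)
  rwa [ContinuousAt, nhds_discrete SignType, tendsto_pure] at hcont

theorem eventually_mem_localFace : ∀ᶠ x in 𝓝 x₀, ∀ τ : Fin 2 → SignType,
    (∀ i, D.localNormal x₀ i ≠ 0 → SignType.sign (D.localCoord x₀ (x - x₀) i) = τ i) →
      x ∈ D.localFace x₀ τ := by
  filter_upwards [eventually_all.2 fun j => eventually_imp_distrib_left.2
    (D.eventually_sign_eq x₀ j)] with x hx τ hτ j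
  beta_reduce
  split_ifs with hj
  · have hne : D.localNormal x₀ (D.family j) ≠ 0 := by
      rw [localNormal_family hj, ← norm_ne_zero_iff, D.norm_normal]
      exact one_ne_zero
    rw [← hτ _ hne, localCoord_apply, localNormal_family hj, inner_sub_right, hj]
  · exact hx j hj

theorem eventually_mem_closure_localFace : ∀ᶠ x in 𝓝 x₀, ∀ τ : Fin 2 → SignType,
    D.localCoord x₀ (x - x₀) ∈ closedOrthant τ → x ∈ closure (D.localFace x₀ τ) := by
  filter_upwards [(D.eventually_mem_localFace x₀).eventually_nhds] with x hx τ hτ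
  have hlim : Tendsto (fun κ : ℝ => x + κ • D.localDir x₀ τ) (𝓝[>] 0) (𝓝 x) :=
    (Continuous.tendsto' (by fun_prop) 0 x (by simp)).mono_left nhdsWithin_le_nhds
  refine mem_closure_of_tendsto hlim ?_
  filter_upwards [hlim.eventually hx, self_mem_nhdsWithin] with κ hκ hκ0
  refine hκ τ fun i hi => ?_
  rw [add_sub_right_comm, map_add, map_smul, Pi.add_apply, Pi.smul_apply,
    localCoord_localDir τ hi, smul_eq_mul]
  exact sign_add_mul_of_mul_eq_abs (hτ i) hκ0

theorem mem_closure_localFace (τ : Fin 2 → SignType) : x₀ ∈ closure (D.localFace x₀ τ) :=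
  (D.eventually_mem_closure_localFace x₀).self_of_nhds τ (by
    rw [sub_self, map_zero]; exact zero_mem _)

theorem localFace_mem_strata (τ : Fin 2 → SignType) : D.localFace x₀ τ ∈ D.strata :=
  face_mem_strata (closure_nonempty_iff.1 ⟨x₀, D.mem_closure_localFace x₀ τ⟩)

variable {D x₀}

theorem mem_tangentConeOf_localFace {τ : Fin 2 → SignType} {v : Euc d}
    (hv : D.localCoord x₀ v ∈ closedOrthant τ) :
    v ∈ tangentConeOf (closure (D.localFace x₀ τ)) x₀ := by
  have hlim : Tendsto (fun t : ℝ => x₀ + t • v) (𝓝[>] 0) (𝓝 x₀) :=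
    (Continuous.tendsto' (by fun_prop) 0 x₀ (by simp)).mono_left nhdsWithin_le_nhds
  refine mem_tangentConeOf_of_eventually_mem ?_
  filter_upwards [hlim.eventually (D.eventually_mem_closure_localFace x₀), self_mem_nhdsWithin]
    with t ht ht0
  refine ht τ ?_
  rw [add_sub_cancel_left, map_smul]
  exact (closedOrthant τ).smul_mem hv (mem_Ioi.1 ht0).le

theorem mem_closure_localFace_inter_closure {τ σ : Fin 2 → SignType} (h : IsFace τ σ) :
    x₀ ∈ closure (D.localFace x₀ τ ∩ closure (D.localFace x₀ σ)) := by
  have hlim : Tendsto (fun κ : ℝ => x₀ + κ • D.localDir x₀ τ) (𝓝[>] 0) (𝓝 x₀) :=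
    (Continuous.tendsto' (by fun_prop) 0 x₀ (by simp)).mono_left nhdsWithin_le_nhds
  refine mem_closure_of_tendsto hlim ?_
  filter_upwards [hlim.eventually (D.eventually_mem_localFace x₀),
    hlim.eventually (D.eventually_mem_closure_localFace x₀), self_mem_nhdsWithin]
    with κ hmem hclosure hκ
  simp only [add_sub_cancel_left, map_smul] at hmem hclosure
  refine ⟨hmem τ fun i hi => ?_, hclosure σ ?_⟩
  · rw [Pi.smul_apply, localCoord_localDir τ hi, smul_eq_mul, sign_mul, sign_pos hκ, one_mul]
    rcases τ i with _ | _ | _ <;> simp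
  · exact (closedOrthant σ).smul_mem (localDir_mem_closedOrthant h) (mem_Ioi.1 hκ).le

end MultiDomain

/-! ### Extension of the dynamics by continuity -/

section ExtDynamics

variable {d N : ℕ} {A : Set (Euc N)} {f : Euc d → Euc N → Euc d} {M : Set (Euc d)} {x₀ : Euc d}

theorem mem_extDynamics_of_forall_frequently {v : Euc d}
    (h : ∀ ε > 0, ∃ᶠ x in 𝓝[M] x₀, v ∈ Metric.thickening ε (dynamics A f x)) :
    v ∈ extDynamics A f M x₀ := by
  refine Metric.mem_closure_iff.2 fun ε hε => ?_
  obtain ⟨x, ⟨hx, hxM⟩, hdist⟩ := (((h ε hε).and_eventually self_mem_nhdsWithin).and_eventually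
    (nhdsWithin_le_nhds (Metric.ball_mem_nhds x₀ hε))).exists
  obtain ⟨w, hw, hvw⟩ := Metric.mem_thickening_iff.1 hx
  exact ⟨(x, w), ⟨hxM, hw⟩, max_lt (Metric.mem_ball'.1 hdist) hvw⟩

theorem isClosed_extDynamics (A : Set (Euc N)) (f : Euc d → Euc N → Euc d) (M : Set (Euc d))
    (x₀ : Euc d) : IsClosed (extDynamics A f M x₀) :=
  isClosed_closure.preimage (Continuous.prodMk_right x₀)

variable {D : MultiDomain d} {c : ℝ} {K : ℝ → ℝ}

theorem HF.eventually_dynamics_subset_thickening (hF : HF D A f c K) (hM : M ∈ D.strata)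
    (x₀ : Euc d) {ε : ℝ} (hε : 0 < ε) :
    ∀ᶠ p in 𝓝[M] x₀ ×ˢ 𝓝[M] x₀, dynamics A f p.1 ⊆ Metric.thickening ε (dynamics A f p.2) := by
  set R := ‖x₀‖ + 1
  have hball : ∀ᶠ x in 𝓝[M] x₀, x ∈ M ∩ Metric.closedBall 0 R := by
    filter_upwards [self_mem_nhdsWithin, nhdsWithin_le_nhds (Metric.ball_mem_nhds x₀ one_pos)]
      with x hxM hx
    refine ⟨hxM, mem_closedBall_zero_iff.2 ?_⟩
    linarith [mem_ball_iff_norm.1 hx, norm_le_norm_add_norm_sub' x x₀]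
  have hdist : ∀ᶠ p in 𝓝[M] x₀ ×ˢ 𝓝[M] x₀, K R * dist p.1 p.2 < ε := by
    have hcont : Continuous fun p : Euc d × Euc d => K R * dist p.1 p.2 := by fun_prop
    refine (hcont.tendsto' (x₀, x₀) 0 (by simp)).eventually_lt_const hε |>.filter_mono ?_
    rw [nhds_prod_eq]
    exact prod_mono nhdsWithin_le_nhds nhdsWithin_le_nhds
  filter_upwards [hball.prod_inl _, hball.prod_inr _, hdist] with p hp₁ hp₂ hp v hv
  exact Metric.mem_thickening_iff.2 (Metric.exists_dist_lt_of_hausdorffDist_lt hv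
    ((hF.lipschitz M hM R _ hp₁ _ hp₂).trans_lt hp)
    (Metric.hausdorffEDist_ne_top_of_nonempty_of_bounded (hF.nonempty _) (hF.nonempty _)
      (hF.isCompact _).isBounded (hF.isCompact _).isBounded))

theorem HF.eventually_extDynamics_subset_thickening (hF : HF D A f c K) (hM : M ∈ D.strata)
    (x₀ : Euc d) {ε : ℝ} (hε : 0 < ε) :
    ∀ᶠ x in 𝓝[M] x₀, extDynamics A f M x₀ ⊆ Metric.thickening ε (dynamics A f x) := by
  obtain ⟨U, hU, V, hV, hUV⟩ :=
    mem_prod_iff.1 (hF.eventually_dynamics_subset_thickening hM x₀ (half_pos hε))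
  filter_upwards [hV] with x hx v hv
  obtain ⟨⟨y, w⟩, ⟨hyM, hw⟩, hyU, hwv⟩ := ((mem_closure_iff_frequently.1 hv).and_eventually
    ((eventually_nhdsWithin_iff.1 hU).prod_nhds (Metric.ball_mem_nhds v (half_pos hε)))).exists
  refine Metric.thickening_mono (add_halves ε).le _ (Metric.thickening_thickening_subset _ _ _
    (Metric.mem_thickening_iff.2 ⟨w, ?_, Metric.mem_ball'.1 hwv⟩))
  exact hUV (mk_mem_prod (hyU hyM) hx) hw

theorem HF.convex_extDynamics (hF : HF D A f c K) (hconv : ∀ x, Convex ℝ (dynamics A f x))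
    (hM : M ∈ D.strata) (hx₀ : x₀ ∈ closure M) : Convex ℝ (extDynamics A f M x₀) := by
  have : (𝓝[M] x₀).NeBot := mem_closure_iff_nhdsWithin_neBot.1 hx₀
  intro v hv w hw a b ha hb hab
  refine mem_extDynamics_of_forall_frequently fun ε hε => Eventually.frequently ?_
  filter_upwards [hF.eventually_extDynamics_subset_thickening hM x₀ hε] with x hx
  exact (hconv x).thickening ε (hx hv) (hx hw) ha hb hab

theorem HF.extDynamics_subset_extDynamics (hF : HF D A f c K) {M' : Set (Euc d)}
    (hM : M ∈ D.strata) (hx₀ : x₀ ∈ closure (M' ∩ closure M)) :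
    extDynamics A f M x₀ ⊆ extDynamics A f M' x₀ := by
  intro v hv
  refine mem_extDynamics_of_forall_frequently fun ε hε => ?_
  have hnear : ∀ᶠ y in 𝓝 x₀, ∀ᶠ x in 𝓝[M] y, v ∈ Metric.thickening (ε / 2) (dynamics A f x) :=
    eventually_nhds_nhdsWithin.2 <|
      (hF.eventually_extDynamics_subset_thickening hM x₀ (half_pos hε)).mono fun _ hx => hx hv
  refine frequently_nhdsWithin_iff.2
    (((mem_closure_iff_frequently.1 hx₀).and_eventually hnear).mono ?_)
  rintro y ⟨⟨hyM', hyM⟩, hy⟩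
  have : (𝓝[M] y).NeBot := mem_closure_iff_nhdsWithin_neBot.1 hyM
  have husc : ∀ᶠ x in 𝓝[M] y, dynamics A f x ⊆ Metric.thickening (ε / 2) (dynamics A f y) :=
    nhdsWithin_le_nhds <| (upperHemicontinuousAt_iff.1 (hF.usc y) _
      (Metric.isOpen_thickening.mem_nhdsSet.2
        (Metric.self_subset_thickening (half_pos hε) _))).mono fun _ => subset_of_mem_nhdsSet
  obtain ⟨x, hvx, hxy⟩ := (hy.and husc).exists
  refine ⟨Metric.thickening_mono (add_halves ε).le _ (Metric.thickening_thickening_subset _ _ _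
    (Metric.thickening_subset_of_subset _ hxy hvx)), hyM'⟩

theorem eventually_forall_of_forall_mem_extDynamics {G : Euc d → Set (Euc d × ℝ)}
    (hGF : ∀ x, ∀ w ∈ G x, w.1 ∈ dynamics A f x) {z₀ : ℝ × Euc d}
    (hG : UpperHemicontinuousAt G z₀.2) (hGc : IsCompact (G z₀.2))
    {P : ℝ × Euc d → Euc d × ℝ → Prop}
    (hP : ∀ w ∈ G z₀.2, w.1 ∈ extDynamics A f M z₀.2 →
      ∀ᶠ p : (ℝ × Euc d) × (Euc d × ℝ) in 𝓝 (z₀, w), P p.1 p.2) :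
    ∀ᶠ z in 𝓝 z₀, z.2 ∈ M → ∀ w ∈ G z.2, P z w := by
  have hG' : UpperHemicontinuousAt (fun z : ℝ × Euc d => G z.2) z₀ :=
    hG.comp continuous_snd.continuousAt
  have hev : ∀ᶠ z in 𝓝 z₀, ∀ w ∈ G z.2, z.2 ∈ M → w.1 ∈ dynamics A f z.2 → P z w := by
    refine eventually_forall_mem_of_upperHemicontinuousAt hG' hGc
      (P := fun z w => z.2 ∈ M → w.1 ∈ dynamics A f z.2 → P z w) fun w hw => ?_
    by_cases hwM : w.1 ∈ extDynamics A f M z₀.2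
    · exact (hP w hw hwM).mono fun _ hp _ _ => hp
    · have hcont : ContinuousAt (fun p : (ℝ × Euc d) × (Euc d × ℝ) => (p.1.2, p.2.1)) (z₀, w) := by
        fun_prop
      filter_upwards [hcont.eventually (isClosed_closure.isOpen_compl.mem_nhds hwM)]
        with p hp hpM hpF
      exact (hp (subset_closure ⟨hpM, hpF⟩)).elim
  filter_upwards [hev] with z hz hzM w hw
  exact hz w hw hzM (hGF _ w hw)

end ExtDynamics

/-! ### Supersolutions -/

section TestFunctions

variable {d : ℕ} {u : ℝ × Euc d → ℝ} {φ : ℝ × Euc d → ℝ} {Q : Set (ℝ × Euc d)}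
  {z₀ : ℝ × Euc d}

theorem exists_test_of_isLocalMin (hQ : Q ∈ 𝓝 z₀) (hφ : ContDiffOn ℝ 1 φ Q)
    (hmin : IsLocalMin (fun z => u z - φ z) z₀) :
    ∃ χ, ContDiffOn ℝ 1 χ Q ∧ fderiv ℝ χ z₀ = fderiv ℝ φ z₀ ∧
      ∀ᶠ z in 𝓝 z₀, u z₀ - χ z₀ + dist z z₀ ^ 2 ≤ u z - χ z := by
  -- The product carries the sup metric, whose square is not differentiable.
  set N : ℝ × Euc d → ℝ := fun z => (z.1 - z₀.1) ^ 2 + ‖z.2 - z₀.2‖ ^ 2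
  have hN : ContDiff ℝ 1 N :=
    ((contDiff_fst.sub contDiff_const).pow 2).add ((contDiff_snd.sub contDiff_const).norm_sq ℝ)
  have hN₀ : N z₀ = 0 := by simp [N]
  have hNmin : IsLocalMin N z₀ := Eventually.of_forall fun z => by
    rw [hN₀]
    positivity
  have hdist : ∀ z, dist z z₀ ^ 2 ≤ N z := by
    intro z
    rw [Prod.dist_eq, Real.dist_eq, dist_eq_norm]
    rcases max_cases |z.1 - z₀.1| ‖z.2 - z₀.2‖ with ⟨h, -⟩ | ⟨h, -⟩ <;> rw [h]
    · rw [sq_abs]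
      exact le_add_of_nonneg_right (sq_nonneg _)
    · exact le_add_of_nonneg_left (sq_nonneg _)
  refine ⟨fun z => φ z - N z, hφ.sub hN.contDiffOn, ?_, ?_⟩
  · rw [fderiv_fun_sub ((hφ.contDiffAt hQ).differentiableAt one_ne_zero)
      (hN.differentiable one_ne_zero z₀), hNmin.fderiv_eq_zero, sub_zero]
  · filter_upwards [hmin] with z hz
    rw [hN₀]
    linarith [hdist z]

theorem exists_test_forall_exists_isLocalMin (hQ : Q ∈ 𝓝 z₀) (hφ : ContDiffOn ℝ 1 φ Q)
    (hmin : IsLocalMin (fun z => u z - φ z) z₀) :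
    ∃ χ, ContDiffOn ℝ 1 χ Q ∧ fderiv ℝ χ z₀ = fderiv ℝ φ z₀ ∧
      ∀ᶠ r in 𝓝[>] (0 : ℝ), ∀ θ : ℝ × Euc d → ℝ,
        LowerSemicontinuousOn (fun z => u z - χ z - θ z) (Metric.closedBall z₀ r) →
        (∀ z ∈ Metric.closedBall z₀ r, θ z < θ z₀ + r ^ 2) →
        ∃ z ∈ Metric.ball z₀ r, θ z₀ ≤ θ z ∧ IsLocalMin (fun z => u z - χ z - θ z) z := by
  obtain ⟨χ, hχ, hderiv, hstrict⟩ := exists_test_of_isLocalMin hQ hφ hmin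
  obtain ⟨R, hR, hball⟩ := Metric.nhds_basis_closedBall.eventually_iff.1 hstrict
  refine ⟨χ, hχ, hderiv, ?_⟩
  filter_upwards [Ioc_mem_nhdsGT hR] with r hr θ hlsc hθ
  exact exists_isLocalMin_sub_of_sq_dist_le hr.1.le
    (fun z hz => hball (Metric.closedBall_subset_closedBall hr.2 hz)) hlsc hθ

end TestFunctions

section Supersolution

variable {d N : ℕ}

/-- Viscosity supersolutions of `-∂_t u + sup_{a ∈ U(x)} (-f(x,a) · Du - ℓ(x,a)) = 0` on
`(0,T) × ℝ^d`. The inequality `-∂_t φ + sup_a … ≥ 0` is expressed by means of the derivative of `φ`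
in the direction `(1, f(x,a))`, up to arbitrarily small errors. -/
def IsSupersolutionFor (U : Euc d → Set (Euc N)) (f : Euc d → Euc N → Euc d)
    (ℓ : Euc d → Euc N → ℝ) (T : ℝ) (u : ℝ × Euc d → ℝ) : Prop :=
  LowerSemicontinuousOn u (Ioc 0 T ×ˢ univ) ∧
    ∀ z ∈ Ioo 0 T ×ˢ univ, ∀ φ : ℝ × Euc d → ℝ, ContDiffOn ℝ 1 φ (Ioo 0 T ×ˢ univ) →
      IsLocalMin (fun z => u z - φ z) z →
      ∀ η > 0, ∃ a ∈ U z.2, fderiv ℝ φ z (1, f z.2 a) + ℓ z.2 a < η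

variable {U U' : Euc d → Set (Euc N)} {f : Euc d → Euc N → Euc d} {ℓ : Euc d → Euc N → ℝ}
  {T : ℝ} {u : ℝ × Euc d → ℝ}

theorem IsSupersolutionFor.lowerSemicontinuousOn_sub (hu : IsSupersolutionFor U f ℓ T u)
    {χ : ℝ × Euc d → ℝ} (hχ : ContinuousOn χ (Ioo 0 T ×ˢ univ)) :
    LowerSemicontinuousOn (fun z => u z - χ z) (Ioo 0 T ×ˢ univ) := by
  simpa only [sub_eq_add_neg] using (hu.1.mono (prod_mono_left Ioo_subset_Ioc_self)).add
    hχ.fun_neg.lowerSemicontinuousOn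

theorem IsSupersolutionFor.mono (hu : IsSupersolutionFor U f ℓ T u) (hU : ∀ x, U x ⊆ U' x) :
    IsSupersolutionFor U' f ℓ T u :=
  ⟨hu.1, fun z hz φ hφ hmin η hη =>
    let ⟨a, ha, h⟩ := hu.2 z hz φ hφ hmin η hη
    ⟨a, hU _ ha, h⟩⟩

theorem fderiv_apply_one_eq_deriv_add_inner_gradient {φ : ℝ × Euc d → ℝ} {t : ℝ} {x : Euc d}
    (h : DifferentiableAt ℝ φ (t, x)) (v : Euc d) :
    fderiv ℝ φ (t, x) (1, v) =
      deriv (fun s => φ (s, x)) t + inner ℝ (gradient (fun y => φ (t, y)) x) v := by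
  have htime : HasFDerivAt (fun s => φ (s, x)) _ t :=
    h.hasFDerivAt.comp t (hasFDerivAt_prodMk_left t x)
  have hspace : HasFDerivAt (fun y => φ (t, y)) _ x :=
    h.hasFDerivAt.comp x (hasFDerivAt_prodMk_right t x)
  rw [gradient, InnerProductSpace.toDual_symm_apply, hspace.fderiv, htime.hasDerivAt.deriv,
    ContinuousLinearMap.comp_apply, ContinuousLinearMap.comp_apply, ← map_add]
  simp

theorem coe_le_biSup_coe_iff {ι : Type*} {s : Set ι} {g : ι → ℝ} {c : ℝ} :
    (c : EReal) ≤ ⨆ a ∈ s, (g a : EReal) ↔ ∀ η > 0, ∃ a ∈ s, c - η < g a := by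
  have hlt (η : ℝ) : (∃ a ∈ s, c - η < g a) ↔ ((c - η : ℝ) : EReal) < ⨆ a ∈ s, (g a : EReal) := by
    simp only [lt_biSup_iff, EReal.coe_lt_coe_iff]
  simp only [hlt]
  refine ⟨fun h η hη => (EReal.coe_lt_coe_iff.2 (sub_lt_self c hη)).trans_le h, fun h =>
    EReal.ge_of_forall_gt_iff_ge.1 fun r hr => ?_⟩
  simpa only [sub_sub_cancel] using (h (c - r) (sub_pos.2 (EReal.coe_lt_coe_iff.1 hr))).le

theorem isSupersolution_iff {D : MultiDomain d} {A : Set (Euc N)} :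
    IsSupersolution D A f ℓ T u ↔ IsSupersolutionFor (essControls D A f) f ℓ T u := by
  refine and_congr_right fun _ => ?_
  simp only [Prod.forall, mem_prod, mem_univ, and_true]
  refine forall_congr' fun t => ?_
  rw [forall_comm]
  refine forall_congr' fun x => forall_congr' fun ht => forall_congr' fun φ =>
    forall_congr' fun hφ => forall_congr' fun _ => ?_
  have hd : DifferentiableAt ℝ φ (t, x) := (hφ.contDiffAt
    ((isOpen_Ioo.prod isOpen_univ).mem_nhds ⟨ht, mem_univ x⟩)).differentiableAt one_ne_zero
  rw [EReal.coe_neg, add_comm, ← sub_eq_add_neg, EReal.sub_nonneg (.inr (EReal.coe_ne_top _))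
    (.inr (EReal.coe_ne_bot _)), essHamiltonian, coe_le_biSup_coe_iff]
  refine forall₂_congr fun η _ => exists_congr fun a => and_congr_right fun _ => ?_
  rw [fderiv_apply_one_eq_deriv_add_inner_gradient hd]
  constructor <;> intro h <;> linarith

end Supersolution

/-! ### Nonessential controls -/

section EssentialControls

variable {d N : ℕ} {D : MultiDomain d} {A : Set (Euc N)} {f : Euc d → Euc N → Euc d}
  {ℓ : Euc d → Euc N → ℝ} {cf cl lam : ℝ} {Kf Kl : ℝ → ℝ}

theorem fst_mem_dynamics {x : Euc d} {w : Euc d × ℝ}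
    (hw : w ∈ augmentedDynamics A f ℓ cl lam x) : w.1 ∈ dynamics A f x := by
  obtain ⟨a, ha, -, -, -, rfl⟩ := hw
  exact mem_image_of_mem _ ha

theorem HL.mem_augmentedDynamics (hL : HL D A ℓ cl lam Kl) (x : Euc d) {a : Euc N} (ha : a ∈ A) :
    (f x a, -ℓ x a) ∈ augmentedDynamics A f ℓ cl lam x :=
  ⟨a, ha, 0, le_rfl, sub_nonneg.2 (hL.growth x _ ⟨a, ha, rfl⟩).2, by rw [sub_zero]⟩

theorem HL.image_fst_augmentedDynamics (hL : HL D A ℓ cl lam Kl) (x : Euc d) :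
    Prod.fst '' augmentedDynamics A f ℓ cl lam x = dynamics A f x := by
  refine Subset.antisymm (image_subset_iff.2 fun w hw => fst_mem_dynamics hw) ?_
  rintro _ ⟨a, ha, rfl⟩
  exact ⟨_, hL.mem_augmentedDynamics x ha, rfl⟩

theorem HL.convex_dynamics (hL : HL D A ℓ cl lam Kl)
    (hG : ∀ x, Convex ℝ (augmentedDynamics A f ℓ cl lam x)) (x : Euc d) :
    Convex ℝ (dynamics A f x) := by
  rw [← hL.image_fst_augmentedDynamics x]
  exact (hG x).linear_image (.fst ℝ (Euc d) ℝ)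

theorem exists_slope_of_forall_essControls (hF : HF D A f cf Kf) (hL : HL D A ℓ cl lam Kl)
    (hG : ∀ x, Convex ℝ (augmentedDynamics A f ℓ cl lam x)) {x₀ : Euc d}
    (hGc : IsCompact (augmentedDynamics A f ℓ cl lam x₀)) {L : ℝ × Euc d →L[ℝ] ℝ} {c : ℝ}
    (hess : ∀ a ∈ essControls D A f x₀, c < L (1, f x₀ a) + ℓ x₀ a) (τ : Fin 2 → SignType) :
    ∃ g : Fin 2 → ℝ, (∀ i, g i ≠ 0) ∧ (∀ i, τ i ≠ 0 → SignType.sign (g i) = -τ i) ∧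
      ∀ w ∈ augmentedDynamics A f ℓ cl lam x₀,
        w.1 ∈ extDynamics A f (D.localFace x₀ τ) x₀ →
          c < L (1, w.1) - w.2 + slopeForm g (D.localCoord x₀ w.1) := by
  have hL₁ (v : Euc d) : L (1, v) = L (1, 0) + L (0, v) := by
    rw [← map_add, Prod.mk_add_mk, add_zero, zero_add]
  have hext : Convex ℝ (extDynamics A f (D.localFace x₀ τ) x₀) :=
    hF.convex_extDynamics (hL.convex_dynamics hG) (D.localFace_mem_strata x₀ τ)
      (D.mem_closure_localFace x₀ τ)
  obtain ⟨g, hg₀, hgτ, hg⟩ := exists_multiplier (τ := τ) (c := c - L (1, 0))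
    (hGc.inter_right ((isClosed_extDynamics A f (D.localFace x₀ τ) x₀).preimage continuous_fst))
    ((hG x₀).inter (hext.linear_preimage (.fst ℝ (Euc d) ℝ)))
    ((L.comp (.inr ℝ ℝ (Euc d))).comp (.fst ℝ (Euc d) ℝ) - .snd ℝ (Euc d) ℝ)
    ((D.localCoord x₀).comp (.fst ℝ (Euc d) ℝ)) (by
      rintro _ ⟨⟨a, ha, r, hr, -, rfl⟩, hfext⟩ hcoord
      have := hess a ⟨ha, _, D.localFace_mem_strata x₀ τ, D.mem_closure_localFace x₀ τ, hfext,
        MultiDomain.mem_tangentConeOf_localFace hcoord⟩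
      rw [hL₁] at this
      simp only [sub_apply, ContinuousLinearMap.comp_apply, ContinuousLinearMap.coe_fst',
        ContinuousLinearMap.inr_apply, ContinuousLinearMap.coe_snd', gt_iff_lt]
      linarith)
  refine ⟨g, hg₀, hgτ, fun w hw hwext => ?_⟩
  have := hg w ⟨hw, hwext⟩
  rw [hL₁]
  simp only [sub_apply, ContinuousLinearMap.comp_apply, ContinuousLinearMap.coe_fst',
    ContinuousLinearMap.inr_apply, ContinuousLinearMap.coe_snd'] at this
  linarith

theorem exists_isInward_of_forall_essControls (hF : HF D A f cf Kf) (hL : HL D A ℓ cl lam Kl)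
    (hG : ∀ x, Convex ℝ (augmentedDynamics A f ℓ cl lam x)) {z₀ : ℝ × Euc d}
    (hGc : IsCompact (augmentedDynamics A f ℓ cl lam z₀.2))
    (hGusc : UpperHemicontinuousAt (augmentedDynamics A f ℓ cl lam) z₀.2)
    {L : ℝ × Euc d → ℝ × Euc d →L[ℝ] ℝ} (hLc : ContinuousAt L z₀) {c : ℝ}
    (hess : ∀ a ∈ essControls D A f z₀.2, c < L z₀ (1, f z₀.2 a) + ℓ z₀.2 a) :
    ∃ s : (Fin 2 → SignType) → Fin 2 → ℝ, IsInward s ∧ ∀ᶠ z in 𝓝 z₀,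
      ∀ g ∈ slopeHull s fun i => SignType.sign (D.localCoord z₀.2 (z.2 - z₀.2) i),
        ∀ a ∈ A, c < L z (1, f z.2 a) + ℓ z.2 a + slopeForm g (D.localCoord z₀.2 (f z.2 a)) := by
  choose s hs₀ hsτ hs using exists_slope_of_forall_essControls hF hL hG hGc hess
  refine ⟨s, ⟨hs₀, hsτ⟩, ?_⟩
  have hfaces : ∀ᶠ z in 𝓝 z₀, ∀ τ σ, IsFace τ σ → z.2 ∈ D.localFace z₀.2 σ →
      ∀ w ∈ augmentedDynamics A f ℓ cl lam z.2,
        c < L z (1, w.1) - w.2 + slopeForm (s τ) (D.localCoord z₀.2 w.1) := by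
    refine eventually_all.2 fun τ => eventually_all.2 fun σ => eventually_imp_distrib_left.2
      fun h => eventually_forall_of_forall_mem_extDynamics (fun _ _ => fst_mem_dynamics) hGusc hGc
        fun w hw hwext => ?_
    have hwτ := hF.extDynamics_subset_extDynamics (D.localFace_mem_strata z₀.2 σ)
      (MultiDomain.mem_closure_localFace_inter_closure h) hwext
    have hcont : ContinuousAt (fun p : (ℝ × Euc d) × (Euc d × ℝ) =>
        L p.1 (1, p.2.1) - p.2.2 + slopeForm (s τ) (D.localCoord z₀.2 p.2.1)) (z₀, w) := by
      fun_prop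
    exact hcont.eventually_const_lt (hs τ w hw hwτ)
  have hlocal := continuous_snd.continuousAt.eventually (D.eventually_mem_localFace z₀.2)
  filter_upwards [hfaces, hlocal] with z hz hface g hg a ha
  set y := D.localCoord z₀.2 (f z.2 a)
  set σ : Fin 2 → SignType := fun i => SignType.sign (D.localCoord z₀.2 (z.2 - z₀.2) i)
  have hhull : slopeHull s σ ⊆ {g | c < L z (1, f z.2 a) + ℓ z.2 a + slopeForm g y} := by
    refine convexHull_min ?_ ?_
    · rintro _ ⟨τ, hτ, rfl⟩
      have := hz τ σ hτ (hface σ fun _ _ => rfl) _ (hL.mem_augmentedDynamics z.2 ha)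
      rwa [sub_neg_eq_add] at this
    · simp only [slopeForm_comm _ y, ← sub_lt_iff_lt_add']
      exact convex_halfSpace_gt (slopeForm y).isLinear _
  exact hhull hg

theorem IsInward.exists_penalty {E : Type*} [NormedAddCommGroup E] [NormedSpace ℝ E]
    {s : (Fin 2 → SignType) → Fin 2 → ℝ} (hs : IsInward s) (M : E →L[ℝ] Fin 2 → ℝ) (x₀ : E)
    {δ : ℝ} (hδ : 0 < δ) :
    ∃ θ : E → ℝ, ContDiff ℝ 1 θ ∧ (∀ x, θ x < θ x₀ + δ) ∧ ∀ x, θ x₀ ≤ θ x →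
      ∃ g ∈ slopeHull s fun i => SignType.sign (M (x - x₀) i),
        HasFDerivAt θ ((slopeForm g).comp M) x := by
  obtain ⟨ψ, hψ, hbdd⟩ := hs.exists_isAdmissible_isBounded
  obtain ⟨C, hC⟩ := hψ.bddAbove hbdd
  have hsmall : ∀ᶠ ε : ℝ in 𝓝[>] 0, ε * C < ε * ψ 0 + δ :=
    nhdsWithin_le_nhds <| ContinuousAt.eventually_lt (by fun_prop) (by fun_prop) (by simpa using hδ)
  obtain ⟨ε, hε, hε₀ : 0 < ε⟩ := (hsmall.and self_mem_nhdsWithin).exists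
  have hθ₀ : ε * ψ (ε⁻¹ • M (x₀ - x₀)) = ε * ψ 0 := by rw [sub_self, map_zero, smul_zero]
  refine ⟨fun x => ε * ψ (ε⁻¹ • M (x - x₀)),
    contDiff_const.mul (hψ.contDiff.comp (by fun_prop)), fun x => ?_, fun x hx => ?_⟩
  · beta_reduce
    rw [hθ₀]
    exact (mul_le_mul_of_nonneg_left (hC (mem_range_self _)) hε₀.le).trans_lt hε
  · have hpos : 0 < ψ (ε⁻¹ • M (x - x₀)) :=
      pos_of_mul_pos_right ((hθ₀ ▸ mul_pos hε₀ hψ.pos_zero).trans_le hx) hε₀.le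
    obtain ⟨g, hg, hgd⟩ := hψ.hasSlopeAt _ hpos
    simp only [Pi.smul_apply, smul_eq_mul, sign_mul, sign_pos (inv_pos.2 hε₀), one_mul] at hg
    have hin : HasFDerivAt (fun x => ε⁻¹ • M (x - x₀)) (ε⁻¹ • M) x :=
      (M.hasFDerivAt.comp x ((hasFDerivAt_id x).sub_const x₀)).const_smul ε⁻¹
    refine ⟨g, hg, ((hgd.comp x hin).const_mul ε).congr_fderiv ?_⟩
    rw [ContinuousLinearMap.comp_smul, smul_smul, mul_inv_cancel₀ hε₀.ne', one_smul]

theorem IsSupersolutionFor.restrict_essControls {T : ℝ} {u : ℝ × Euc d → ℝ} (hF : HF D A f cf Kf)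
    (hL : HL D A ℓ cl lam Kl) (hGc : ∀ x, IsCompact (augmentedDynamics A f ℓ cl lam x))
    (hGusc : UpperHemicontinuous (augmentedDynamics A f ℓ cl lam))
    (hG : ∀ x, Convex ℝ (augmentedDynamics A f ℓ cl lam x))
    (hu : IsSupersolutionFor (fun _ => A) f ℓ T u) :
    IsSupersolutionFor (essControls D A f) f ℓ T u := by
  refine ⟨hu.1, fun z₀ hz₀ φ hφ hmin η hη => ?_⟩
  by_contra! hess
  have hopen : IsOpen (Ioo 0 T ×ˢ (univ : Set (Euc d))) := isOpen_Ioo.prod isOpen_univ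
  have hQ := hopen.mem_nhds hz₀
  obtain ⟨χ, hχ, hχφ, htest⟩ := exists_test_forall_exists_isLocalMin hQ hφ hmin
  obtain ⟨s, hs, hgood⟩ := exists_isInward_of_forall_essControls hF hL hG (hGc _) (hGusc _)
    ((hχ.continuousOn_fderiv_of_isOpen hopen le_rfl).continuousAt hQ) (c := η / 2)
    fun a ha => hχφ ▸ (half_lt_self hη).trans_le (hess a ha)
  have hball := (eventually_closedBall_subset (hgood.and hQ)).filter_mono
    (nhdsWithin_le_nhds (s := Ioi 0))
  obtain ⟨r, ⟨htest, hball⟩, hr : 0 < r⟩ := ((htest.and hball).and self_mem_nhdsWithin).exists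
  obtain ⟨θ, hθ, hθr, hθd⟩ :=
    hs.exists_penalty ((D.localCoord z₀.2).comp (.snd ℝ ℝ (Euc d))) z₀ (pow_pos hr 2)
  have hχθ : ContDiffOn ℝ 1 (fun z => χ z + θ z) (Ioo 0 T ×ˢ univ) := hχ.add hθ.contDiffOn
  simp only [sub_sub] at htest
  obtain ⟨z, hz, hθz, hzmin⟩ := htest θ (hu.lowerSemicontinuousOn_sub hχθ.continuousOn |>.mono
    fun z hz => (hball hz).2) fun z _ => hθr z
  obtain ⟨hgoodz, hzQ⟩ := hball (Metric.ball_subset_closedBall hz)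
  obtain ⟨g, hg, hgd⟩ := hθd z hθz
  obtain ⟨a, ha, hlt⟩ := hu.2 z hzQ _ hχθ hzmin (η / 2) (half_pos hη)
  have hχd := (hχ.differentiableOn one_ne_zero).differentiableAt (hopen.mem_nhds hzQ)
  rw [(hχd.hasFDerivAt.fun_add hgd).fderiv] at hlt
  refine (hgoodz g hg a ha).not_gt ?_
  simpa only [add_apply, ContinuousLinearMap.comp_apply, ContinuousLinearMap.coe_snd',
    add_right_comm] using hlt

end EssentialControls

/-! ### Stability -/

section Stability

variable {d N : ℕ} {D : MultiDomain d} {A : Set (Euc N)} {f : Euc d → Euc N → Euc d}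
  {ℓ : Euc d → Euc N → ℝ} {cl lam : ℝ} {Kl : ℝ → ℝ}

theorem lowerSemicontinuousOn_of_tendstoLocallyUniformlyOn {X ι : Type*} [TopologicalSpace X]
    {s : Set X} {p : Filter ι} [p.NeBot] {F : ι → X → ℝ} {g : X → ℝ}
    (hF : ∀ i, LowerSemicontinuousOn (F i) s) (h : TendstoLocallyUniformlyOn F g p s) :
    LowerSemicontinuousOn g s := by
  intro x hx c hc
  obtain ⟨b, hcb, hb⟩ := exists_between hc
  obtain ⟨t, ht, hclose⟩ := Metric.tendstoLocallyUniformlyOn_iff.1 h (min (b - c) (g x - b))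
    (lt_min (sub_pos.2 hcb) (sub_pos.2 hb)) x hx
  obtain ⟨i, hi⟩ := hclose.exists
  have hlt (y : X) (hy : y ∈ t) := lt_min_iff.1 (hi y hy)
  have hix := (abs_sub_lt_iff.1 (hlt x (mem_of_mem_nhdsWithin hx ht)).2).1
  filter_upwards [ht, hF i x hx b (by linarith)] with y hy hby
  have := (abs_sub_lt_iff.1 (hlt y hy).1).2
  linarith

theorem HL.eventually_forall_lt_of_forall_lt (hL : HL D A ℓ cl lam Kl) {z₀ : ℝ × Euc d}
    (hGc : IsCompact (augmentedDynamics A f ℓ cl lam z₀.2))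
    (hGusc : UpperHemicontinuousAt (augmentedDynamics A f ℓ cl lam) z₀.2)
    {L : ℝ × Euc d → ℝ × Euc d →L[ℝ] ℝ} (hLc : ContinuousAt L z₀) {c : ℝ}
    (h : ∀ a ∈ A, c < L z₀ (1, f z₀.2 a) + ℓ z₀.2 a) :
    ∀ᶠ p in 𝓝 (z₀, (0 : Euc d × ℝ)), ∀ a ∈ A,
      c < L p.1 (1, f p.1.2 a + p.2.1) + (ℓ p.1.2 a + p.2.2) := by
  have hG' : UpperHemicontinuousAt (fun p : (ℝ × Euc d) × (Euc d × ℝ) =>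
      augmentedDynamics A f ℓ cl lam p.1.2) (z₀, 0) :=
    UpperHemicontinuousAt.comp (g := fun p : (ℝ × Euc d) × (Euc d × ℝ) => p.1.2) (c := (z₀, 0))
      hGusc (by fun_prop)
  have hG : ∀ᶠ p in 𝓝 (z₀, (0 : Euc d × ℝ)), ∀ w ∈ augmentedDynamics A f ℓ cl lam p.1.2,
      c < L p.1 (1, w.1 + p.2.1) + (-w.2 + p.2.2) := by
    refine eventually_forall_mem_of_upperHemicontinuousAt hG' hGc
      (P := fun p w => c < L p.1 (1, w.1 + p.2.1) + (-w.2 + p.2.2)) fun w hw => ?_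
    have hcont : ContinuousAt (fun p : ((ℝ × Euc d) × (Euc d × ℝ)) × (Euc d × ℝ) =>
        L p.1.1 (1, p.2.1 + p.1.2.1) + (-p.2.2 + p.1.2.2)) ((z₀, 0), w) := by
      fun_prop
    refine hcont.eventually_const_lt ?_
    obtain ⟨a, ha, r, hr, -, rfl⟩ := hw
    have := h a ha
    simp only [Prod.fst_zero, Prod.snd_zero, add_zero]
    linarith
  filter_upwards [hG] with p hp a ha
  simpa only [neg_neg] using hp _ (hL.mem_augmentedDynamics p.1.2 ha)

variable {fn : ℕ → Euc d → Euc N → Euc d} {ℓn : ℕ → Euc d → Euc N → ℝ}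

theorem HL.eventually_forall_lt_of_tendstoLocallyUniformlyOn (hL : HL D A ℓ cl lam Kl)
    (hA : IsCompact A) {z₀ : ℝ × Euc d} (hGc : IsCompact (augmentedDynamics A f ℓ cl lam z₀.2))
    (hGusc : UpperHemicontinuousAt (augmentedDynamics A f ℓ cl lam) z₀.2)
    (hfconv : TendstoLocallyUniformlyOn (fun n z => fn n z.1 z.2)
      (fun z : Euc d × Euc N => f z.1 z.2) atTop (univ ×ˢ A))
    (hℓconv : TendstoLocallyUniformlyOn (fun n z => ℓn n z.1 z.2)
      (fun z : Euc d × Euc N => ℓ z.1 z.2) atTop (univ ×ˢ A))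
    {L : ℝ × Euc d → ℝ × Euc d →L[ℝ] ℝ} (hLc : ContinuousAt L z₀) {c : ℝ}
    (h : ∀ a ∈ A, c < L z₀ (1, f z₀.2 a) + ℓ z₀.2 a) :
    ∀ᶠ p in atTop ×ˢ 𝓝 z₀, ∀ a ∈ A, c < L p.2 (1, fn p.1 p.2.2 a) + ℓn p.1 p.2.2 a := by
  have hpert := hL.eventually_forall_lt_of_forall_lt hGc hGusc hLc h
  rw [nhds_prod_eq, eventually_prod_iff] at hpert
  obtain ⟨P, hP, P', hP', hPP'⟩ := hpert
  obtain ⟨δ, hδ, hδP'⟩ := Metric.eventually_nhds_iff_ball.1 hP'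
  have hdata := Metric.tendstoUniformlyOn_iff.1
    ((tendstoLocallyUniformlyOn_iff_tendstoUniformlyOn_of_compact
      ((isCompact_closedBall z₀.2 1).prod hA)).1
      ((hfconv.prodMk hℓconv).mono (prod_mono_left (subset_univ _)))) δ hδ
  have hnear : ∀ᶠ z in 𝓝 z₀, z.2 ∈ Metric.closedBall z₀.2 1 :=
    continuous_snd.continuousAt (Metric.closedBall_mem_nhds z₀.2 one_pos)
  filter_upwards [hdata.prod_mk (hP.and hnear)] with p ⟨hn, hPz, hz⟩ a ha
  have hclose := hn (p.2.2, a) ⟨hz, ha⟩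
  rw [dist_comm, dist_eq_norm, Prod.mk_sub_mk, ← mem_ball_zero_iff] at hclose
  simpa only [add_sub_cancel] using hPP' hPz (hδP' _ hclose) a ha

theorem HL.isSupersolutionFor_of_tendstoLocallyUniformlyOn {T : ℝ} {un : ℕ → ℝ × Euc d → ℝ}
    {u : ℝ × Euc d → ℝ} (hL : HL D A ℓ cl lam Kl) (hA : IsCompact A)
    (hGc : ∀ x, IsCompact (augmentedDynamics A f ℓ cl lam x))
    (hGusc : UpperHemicontinuous (augmentedDynamics A f ℓ cl lam))
    (hfconv : TendstoLocallyUniformlyOn (fun n z => fn n z.1 z.2)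
      (fun z : Euc d × Euc N => f z.1 z.2) atTop (univ ×ˢ A))
    (hℓconv : TendstoLocallyUniformlyOn (fun n z => ℓn n z.1 z.2)
      (fun z : Euc d × Euc N => ℓ z.1 z.2) atTop (univ ×ˢ A))
    (hun : ∀ n, IsSupersolutionFor (fun _ => A) (fn n) (ℓn n) T (un n))
    (huconv : TendstoLocallyUniformlyOn un u atTop (Ioc 0 T ×ˢ univ)) :
    IsSupersolutionFor (fun _ => A) f ℓ T u := by
  refine ⟨lowerSemicontinuousOn_of_tendstoLocallyUniformlyOn (fun n => (hun n).1) huconv,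
    fun z₀ hz₀ φ hφ hmin η hη => ?_⟩
  by_contra! hess
  have hopen : IsOpen (Ioo 0 T ×ˢ (univ : Set (Euc d))) := isOpen_Ioo.prod isOpen_univ
  have hQ := hopen.mem_nhds hz₀
  obtain ⟨χ, hχ, hχφ, htest⟩ := exists_test_forall_exists_isLocalMin hQ hφ hmin
  obtain ⟨P, hP, P', hP', hgood⟩ := eventually_prod_iff.1 <|
    hL.eventually_forall_lt_of_tendstoLocallyUniformlyOn hA (hGc _) (hGusc _) hfconv hℓconv
      ((hχ.continuousOn_fderiv_of_isOpen hopen le_rfl).continuousAt hQ) (c := η / 2)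
      fun a ha => hχφ ▸ (half_lt_self hη).trans_le (hess a ha)
  have hball := (eventually_closedBall_subset (hP'.and hQ)).filter_mono
    (nhdsWithin_le_nhds (s := Ioi 0))
  obtain ⟨r, ⟨htest, hball⟩, hr : 0 < r⟩ := ((htest.and hball).and self_mem_nhdsWithin).exists
  have hclose := Metric.tendstoUniformlyOn_iff.1
    ((tendstoLocallyUniformlyOn_iff_tendstoUniformlyOn_of_compact (isCompact_closedBall z₀ r)).1
      (huconv.mono fun z hz => prod_mono_left Ioo_subset_Ioc_self (hball hz).2))
      (r ^ 2 / 2) (by positivity)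
  obtain ⟨n, hn, hPn⟩ := (hclose.and hP).exists
  have hsub : (fun z => u z - χ z - (u z - un n z)) = fun z => un n z - χ z := by
    funext z
    ring
  obtain ⟨z, hz, -, hzmin⟩ := htest (fun z => u z - un n z)
    (hsub ▸ ((hun n).lowerSemicontinuousOn_sub hχ.continuousOn).mono fun z hz => (hball hz).2)
    fun z hz => by
      have h₁ := (abs_sub_lt_iff.1 (hn z hz)).1
      have h₂ := (abs_sub_lt_iff.1 (hn z₀ (Metric.mem_closedBall_self hr.le))).2
      linarith
  obtain ⟨hP'z, hzQ⟩ := hball (Metric.ball_subset_closedBall hz)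
  obtain ⟨a, ha, hlt⟩ := (hun n).2 z hzQ χ hχ (hsub ▸ hzmin) (η / 2) (half_pos hη)
  exact (hgood hPn hP'z a ha).not_gt hlt

end Stability

theorem mainTheorem10_general {d N : ℕ} {D : MultiDomain d} {A : Set (Euc N)} (hA : IsCompact A)
    {f : Euc d → Euc N → Euc d} {ℓ : Euc d → Euc N → ℝ} {fn : ℕ → Euc d → Euc N → Euc d}
    {ℓn : ℕ → Euc d → Euc N → ℝ} {T cf cl lam : ℝ} {Kf Kl : ℝ → ℝ}
    (hF : HF D A f cf Kf) (hL : HL D A ℓ cl lam Kl)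
    (hGcompact : ∀ x, IsCompact (augmentedDynamics A f ℓ cl lam x))
    (hGusc : UpperHemicontinuous (augmentedDynamics A f ℓ cl lam))
    (hGconvex : ∀ x, Convex ℝ (augmentedDynamics A f ℓ cl lam x))
    (hfconv : TendstoLocallyUniformlyOn (fun n z => fn n z.1 z.2)
      (fun z : Euc d × Euc N => f z.1 z.2) atTop (univ ×ˢ A))
    (hℓconv : TendstoLocallyUniformlyOn (fun n z => ℓn n z.1 z.2)
      (fun z : Euc d × Euc N => ℓ z.1 z.2) atTop (univ ×ˢ A))
    {un : ℕ → ℝ × Euc d → ℝ} {u : ℝ × Euc d → ℝ}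
    (hun : ∀ n, IsSupersolutionFor (fun _ => A) (fn n) (ℓn n) T (un n))
    (huconv : TendstoLocallyUniformlyOn un u atTop (Ioc 0 T ×ˢ univ)) :
    IsSupersolution D A f ℓ T u :=
  isSupersolution_iff.2 <| IsSupersolutionFor.restrict_essControls hF hL hGcompact hGusc hGconvex <|
    hL.isSupersolutionFor_of_tendstoLocallyUniformlyOn hA hGcompact hGusc hfconv hℓconv hun huconv

theorem mainTheorem10 {d N : ℕ} (D : MultiDomain d)
    (A : Set (Euc N)) (hA : IsCompact A)
    (f : Euc d → Euc N → Euc d) (ℓ : Euc d → Euc N → ℝ)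
    (fn : ℕ → Euc d → Euc N → Euc d) (ℓn : ℕ → Euc d → Euc N → ℝ)
    (T : ℝ) (hT : 0 < T)
    -- hypotheses on the limit problem
    (cf cl lam : ℝ) (Kf Kl : ℝ → ℝ)
    (hF : HF D A f cf Kf) (hL : HL D A ℓ cl lam Kl)
    (hGcompact : ∀ x, IsCompact (augmentedDynamics A f ℓ cl lam x))
    (hGusc : UpperHemicontinuous (augmentedDynamics A f ℓ cl lam))
    (hGconvex : ∀ x, Convex ℝ (augmentedDynamics A f ℓ cl lam x))
    (hcontrollable : ∃ r₁ > 0, ∀ x ∈ D.Γ, Metric.ball 0 r₁ ⊆ dynamics A f x)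
    -- the perturbed problems satisfy the standing hypotheses with constants uniform in `n`
    (cf' cl' lam' : ℝ) (Kf' Kl' : ℝ → ℝ)
    (hFn : ∀ n, HF D A (fn n) cf' Kf') (hLn : ∀ n, HL D A (ℓn n) cl' lam' Kl')
    -- locally uniform convergence of the data
    (hfconv : TendstoLocallyUniformlyOn (fun n z => fn n z.1 z.2)
      (fun z : Euc d × Euc N => f z.1 z.2) atTop (univ ×ˢ A))
    (hℓconv : TendstoLocallyUniformlyOn (fun n z => ℓn n z.1 z.2)
      (fun z : Euc d × Euc N => ℓ z.1 z.2) atTop (univ ×ˢ A))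
    -- the supersolutions of the perturbed equations and their limit
    (un : ℕ → ℝ × Euc d → ℝ) (u : ℝ × Euc d → ℝ)
    (hun : ∀ n, IsSupersolution D A (fn n) (ℓn n) T (un n))
    (hu : LowerSemicontinuousOn u (Icc 0 T ×ˢ univ))
    (huconv : TendstoLocallyUniformlyOn un u atTop (Icc 0 T ×ˢ univ)) :
    IsSupersolution D A f ℓ T u :=
  mainTheorem10_general hA hF hL hGcompact hGusc hGconvex hfconv hℓconv
    (fun n => (isSupersolution_iff.1 (hun n)).mono fun _ _ ha => ha.1)
    (huconv.mono (prod_mono_left Ioc_subset_Icc_self))
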